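/- Let $\mathfrak g'$ be a simple simply-laced finite-dimensional complex Lie algebra with Dynkin diagram $I'$, Cartan matrix $C'$ and simple coroots $\alpha_i'^\vee$ $(i\in I')$, and let $\sigma$ be an automorphism of the Dynkin diagram such that no two distinct nodes in one $\sigma$-orbit are adjacent (that is, $\sigma$ is trivial if $\mathfrak g'$ has type $A_{2n}$). Let $I$ be the set of $\sigma$-orbits in $I'$. Let $\mathfrak g=(\mathfrak g')^\sigma$, with Cartan matrix $C_{JK}=\sum_{i\in J}C'_{ij}$ (for any $j\in K$; $J,K\in I$), and let ${}^L\mathfrak g$ be its Langlands dual, with the transposed Cartan matrix. Identify the lattice ${}^LP$ of integral weights of ${}^L\mathfrak g$ with the lattice $P^\sigma$ of $\sigma$-invariant integral weights of $\mathfrak g'$ by sending the fundamental weight of an orbit $J\in I$ to $\sum_{i\in J}\omega_i'$. Let $q\in\mathbb C^\times$ be not a root of unity, and let $U_q(\mathfrak g')$ and $U_q({}^L\mathfrak g)$ be the Drinfeld--Jimbo quantum groups over $\mathbb C$, where for ${}^L\mathfrak g$ one puts $q_J=q^{|J|}$ for $J\in I$. A vector has weight $\gamma$ if each $k_i$ acts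 on it by $q_i^{\langle\gamma,\alpha_i^\vee\rangle}$. Denote also by $\sigma$ the automorphism of $U_q(\mathfrak g')$ with $e_i\mapsto e_{\sigma(i)}$, $f_i\mapsto f_{\sigma(i)}$, $k_i^{\pm1}\mapsto k_{\sigma(i)}^{\pm1}$. Let $W$ be a simple finite-dimensional $U_q(\mathfrak g')$-module whose highest weight $\lambda$ is an integral $\sigma$-invariant weight. Then there is a unique linear automorphism $\widehat\sigma$ of $W$ such that $\sigma(g)=\widehat\sigma\, g\,\widehat\sigma^{-1}$ on $W$ for all $g\in U_q(\mathfrak g')$ and $\widehat\sigma$ is the identity on the highest weight space $W_\lambda$. Let $W^\sigma$ be the span of all weight vectors of $W$ that are fixed by $\widehat\sigma$; it is graded by $P^\sigma\cong{}^LP$, with components $W^\sigma_\gamma=\{w\in W_\gamma:\widehat\sigma(w)=w\}$. Then its character $$\chi(W^\sigma)=\sum_{\gamma\in P^\sigma\cong{}^LP}\dim(W^\sigma_\gamma)\,e^\gamma\in\mathbb Z[{}^LP]$$ is invariant under the Weyl group of ${}^L\mathfrak g$. Hence it is the character of a virtual representation of $U_q({}^L\mathfrak g)$, i.e. there are finite-dimensional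 $U_q({}^L\mathfrak g)$-modules $M,N$, each the direct sum of its integral weight spaces, with $\chi(W^\sigma)=\chi(M)-\chi(N)$. -/

import Mathlib

noncomputable section

namespace FoldedQG

/-! ### Cartan data of finite type -/

/-- A Cartan matrix of finite type, `C i j = ⟨α_j, α_i^∨⟩ = 2 (α_i, α_j) / (α_i, α_i)`, together
with positive integers `d i`, proportional to `(α_i, α_i) / 2`, such that `(d i * C i j)` is a
symmetric positive definite matrix. -/
structure CartanDatum (I : Type*) where
  C : Matrix I I ℤ
  d : I → ℕ
  C_diag : ∀ i, C i i = 2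
  C_nonpos : ∀ i j, i ≠ j → C i j ≤ 0
  d_pos : ∀ i, 0 < d i
  posDef : (Matrix.of fun i j => (d i : ℝ) * (C i j : ℝ)).PosDef

namespace CartanDatum

variable {I : Type*} (D : CartanDatum I)

/-- The underlying graph of the Dynkin diagram. -/
def dynkinGraph : SimpleGraph I := SimpleGraph.fromRel fun i j => D.C i j ≠ 0

/-- The integral weight lattice, in the basis of fundamental weights:
the `i`-th coordinate of `γ` is `⟨γ, α_i^∨⟩`. -/
abbrev Weight (_D : CartanDatum I) : Type _ := I → ℤ

/-- The simple root `α_i`, expressed in fundamental weights. -/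
def simpleRoot (i : I) : D.Weight := fun j => D.C j i

/-- The simple reflection `s_i γ = γ - ⟨γ, α_i^∨⟩ α_i` of the weight lattice. -/
def simpleReflection (i : I) : D.Weight ≃ₗ[ℤ] D.Weight :=
  Module.reflection (R := ℤ) (M := D.Weight) (x := D.simpleRoot i)
    (f := LinearMap.proj i) (D.C_diag i)

/-- The Weyl group, as a group of automorphisms of the weight lattice. -/
def weylGroup : Subgroup (D.Weight ≃ₗ[ℤ] D.Weight) :=
  Subgroup.closure (Set.range D.simpleReflection)

end CartanDatum

/-! ### Quantum groups -/

/-- `q` is a non-zero complex number which is not a root of unity. -/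
def IsGenericParam (q : ℂ) : Prop := q ≠ 0 ∧ ∀ n : ℕ, 0 < n → q ^ n ≠ 1

/-- The quantum integer `[n]_q`. -/
def qInt (q : ℂ) (n : ℕ) : ℂ := (q ^ (n : ℤ) - q ^ (-(n : ℤ))) / (q - q⁻¹)

/-- The quantum factorial `[n]_q!`. -/
def qFactorial (q : ℂ) (n : ℕ) : ℂ := ∏ m ∈ Finset.range n, qInt q (m + 1)

/-- The quantum binomial coefficient. -/
def qBinom (q : ℂ) (n r : ℕ) : ℂ := qFactorial q n / (qFactorial q r * qFactorial q (n - r))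

/-- The Drinfeld--Jimbo generators `e_i`, `f_i`, `k_i`, `k_i⁻¹`. -/
inductive Gen (I : Type*) : Type _
  | e : I → Gen I
  | f : I → Gen I
  | k : I → Gen I
  | kinv : I → Gen I

/-- The left-hand side of the quantum Serre relation
`∑_r (-1)^r [n choose r]_q x^{n-r} y x^r`. -/
def serreElement {A : Type*} [Ring A] [Algebra ℂ A] (q : ℂ) (n : ℕ) (x y : A) : A :=
  ∑ r ∈ Finset.range (n + 1), ((-1) ^ r * qBinom q n r) • (x ^ (n - r) * y * x ^ r)

open FreeAlgebra in
/-- The defining relations of `U_q(𝔤)`, where `q_i = q ^ (d i)`. -/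
inductive UqRel {I : Type*} (D : CartanDatum I) (q : ℂ) :
    FreeAlgebra ℂ (Gen I) → FreeAlgebra ℂ (Gen I) → Prop
  | k_kinv (i : I) : UqRel D q (ι ℂ (Gen.k i) * ι ℂ (Gen.kinv i)) 1
  | kinv_k (i : I) : UqRel D q (ι ℂ (Gen.kinv i) * ι ℂ (Gen.k i)) 1
  | k_k (i j : I) : UqRel D q (ι ℂ (Gen.k i) * ι ℂ (Gen.k j)) (ι ℂ (Gen.k j) * ι ℂ (Gen.k i))
  | k_e (i j : I) : UqRel D q (ι ℂ (Gen.k i) * ι ℂ (Gen.e j))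
      ((q ^ D.d i) ^ (D.C i j) • (ι ℂ (Gen.e j) * ι ℂ (Gen.k i)))
  | k_f (i j : I) : UqRel D q (ι ℂ (Gen.k i) * ι ℂ (Gen.f j))
      ((q ^ D.d i) ^ (-D.C i j) • (ι ℂ (Gen.f j) * ι ℂ (Gen.k i)))
  | e_f (i : I) : UqRel D q
      (ι ℂ (Gen.e i) * ι ℂ (Gen.f i) - ι ℂ (Gen.f i) * ι ℂ (Gen.e i))
      ((q ^ D.d i - (q ^ D.d i)⁻¹)⁻¹ • (ι ℂ (Gen.k i) - ι ℂ (Gen.kinv i)))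
  | e_f_ne (i j : I) : i ≠ j → UqRel D q
      (ι ℂ (Gen.e i) * ι ℂ (Gen.f j) - ι ℂ (Gen.f j) * ι ℂ (Gen.e i)) 0
  | serre_e (i j : I) : i ≠ j → UqRel D q
      (serreElement (q ^ D.d i) (1 - D.C i j).toNat (ι ℂ (Gen.e i)) (ι ℂ (Gen.e j))) 0
  | serre_f (i j : I) : i ≠ j → UqRel D q
      (serreElement (q ^ D.d i) (1 - D.C i j).toNat (ι ℂ (Gen.f i)) (ι ℂ (Gen.f j))) 0

/-- The quantum group `U_q(𝔤)`: the `ℂ`-algebra with the Drinfeld--Jimbo generators and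
relations. -/
def Uq {I : Type*} (D : CartanDatum I) (q : ℂ) : Type _ := RingQuot (UqRel D q)

namespace Uq

variable {I : Type*} (D : CartanDatum I) (q : ℂ)

instance : Ring (Uq D q) := inferInstanceAs (Ring (RingQuot (UqRel D q)))

instance : Algebra ℂ (Uq D q) := inferInstanceAs (Algebra ℂ (RingQuot (UqRel D q)))

/-- The quotient map from the free algebra. -/
def proj : FreeAlgebra ℂ (Gen I) →ₐ[ℂ] Uq D q := RingQuot.mkAlgHom ℂ (UqRel D q)

/-- The image of a generator in `U_q(𝔤)`. -/
def gen (x : Gen I) : Uq D q := proj D q (FreeAlgebra.ι ℂ x)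

/-- The generator `e_i`. -/
abbrev e (i : I) : Uq D q := gen D q (Gen.e i)

/-- The generator `k_i`. -/
abbrev k (i : I) : Uq D q := gen D q (Gen.k i)

variable {D q}

theorem proj_rel {x y : FreeAlgebra ℂ (Gen I)} (h : UqRel D q x y) :
    proj D q x = proj D q y :=
  RingQuot.mkAlgHom_rel ℂ h

/-- The universal property of `U_q(𝔤)`. -/
def lift {A : Type*} [Ring A] [Algebra ℂ A] (φ : FreeAlgebra ℂ (Gen I) →ₐ[ℂ] A)
    (h : ∀ ⦃x y⦄, UqRel D q x y → φ x = φ y) : Uq D q →ₐ[ℂ] A :=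
  RingQuot.liftAlgHom ℂ ⟨φ, h⟩

theorem lift_proj {A : Type*} [Ring A] [Algebra ℂ A] (φ : FreeAlgebra ℂ (Gen I) →ₐ[ℂ] A)
    (h : ∀ ⦃x y⦄, UqRel D q x y → φ x = φ y) (x : FreeAlgebra ℂ (Gen I)) :
    lift φ h (proj D q x) = φ x :=
  RingQuot.liftAlgHom_mkAlgHom_apply ℂ φ h x

theorem lift_gen {A : Type*} [Ring A] [Algebra ℂ A] (φ : FreeAlgebra ℂ (Gen I) →ₐ[ℂ] A)
    (h : ∀ ⦃x y⦄, UqRel D q x y → φ x = φ y) (x : Gen I) :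
    lift φ h (gen D q x) = φ (FreeAlgebra.ι ℂ x) :=
  lift_proj φ h _

theorem hom_ext {A : Type*} [Ring A] [Algebra ℂ A] {φ ψ : Uq D q →ₐ[ℂ] A}
    (h : ∀ x, φ (gen D q x) = ψ (gen D q x)) : φ = ψ := by
  refine RingQuot.ringQuot_ext' ℂ φ ψ (FreeAlgebra.hom_ext (funext fun x => ?_))
  exact h x

end Uq

/-! ### Diagram automorphisms -/

namespace CartanDatum

variable {I : Type*} (D : CartanDatum I)

/-- `σ` is an automorphism of the Dynkin diagram. -/
def IsDiagramAut (σ : Equiv.Perm I) : Prop :=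
  (∀ i j, D.C (σ i) (σ j) = D.C i j) ∧ ∀ i, D.d (σ i) = D.d i

theorem IsDiagramAut.symm {D : CartanDatum I} {σ : Equiv.Perm I} (h : D.IsDiagramAut σ) :
    D.IsDiagramAut σ.symm := by
  refine ⟨fun i j => ?_, fun i => ?_⟩
  · simpa using (h.1 (σ.symm i) (σ.symm j)).symm
  · simpa using (h.2 (σ.symm i)).symm

end CartanDatum

/-- The action of a permutation of the index set on the generators. -/
def Gen.map {I : Type*} (σ : Equiv.Perm I) : Gen I → Gen I
  | .e i => .e (σ i)
  | .f i => .f (σ i)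
  | .k i => .k (σ i)
  | .kinv i => .kinv (σ i)

namespace Uq

variable {I : Type*} {D : CartanDatum I} (q : ℂ) {σ : Equiv.Perm I}

theorem map_serreElement {A B : Type*} [Ring A] [Algebra ℂ A] [Ring B] [Algebra ℂ B]
    (φ : A →ₐ[ℂ] B) (q : ℂ) (n : ℕ) (x y : A) :
    φ (serreElement q n x y) = serreElement q n (φ x) (φ y) := by
  simp [serreElement, map_sum, map_smul]

theorem diagramHom_rel (h : D.IsDiagramAut σ) ⦃x y : FreeAlgebra ℂ (Gen I)⦄
    (hxy : UqRel D q x y) :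
    FreeAlgebra.lift ℂ (fun g => gen D q (g.map σ)) x =
      FreeAlgebra.lift ℂ (fun g => gen D q (g.map σ)) y := by
  have key : ∀ {x' y' : FreeAlgebra ℂ (Gen I)}, UqRel D q x' y' →
      proj D q x' = proj D q y' := proj_rel
  induction hxy with
  | k_kinv i => simpa [Gen.map, gen] using key (.k_kinv (σ i))
  | kinv_k i => simpa [Gen.map, gen] using key (.kinv_k (σ i))
  | k_k i j => simpa [Gen.map, gen] using key (.k_k (σ i) (σ j))
  | k_e i j => simpa [Gen.map, gen, h.1, h.2] using key (.k_e (σ i) (σ j))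
  | k_f i j => simpa [Gen.map, gen, h.1, h.2] using key (.k_f (σ i) (σ j))
  | e_f i => simpa [Gen.map, gen, h.1, h.2] using key (.e_f (σ i))
  | e_f_ne i j hij => simpa [Gen.map, gen] using key (.e_f_ne (σ i) (σ j) (by simpa using hij))
  | serre_e i j hij =>
    simpa [Gen.map, gen, map_serreElement, h.1, h.2] using
      key (.serre_e (σ i) (σ j) (by simpa using hij))
  | serre_f i j hij =>
    simpa [Gen.map, gen, map_serreElement, h.1, h.2] using
      key (.serre_f (σ i) (σ j) (by simpa using hij))

/-- The algebra endomorphism of `U_q(𝔤)` with `e_i ↦ e_{σ(i)}`, `f_i ↦ f_{σ(i)}`,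
`k_i^{±1} ↦ k_{σ(i)}^{±1}`. -/
def diagramHom (h : D.IsDiagramAut σ) : Uq D q →ₐ[ℂ] Uq D q :=
  lift (FreeAlgebra.lift ℂ fun g => gen D q (g.map σ)) (diagramHom_rel q h)

theorem diagramHom_gen (h : D.IsDiagramAut σ) (g : Gen I) :
    diagramHom q h (gen D q g) = gen D q (g.map σ) := by
  simp [diagramHom, lift_gen]

/-- The automorphism `σ` of the algebra `U_q(𝔤)` induced by an automorphism `σ` of the Dynkin
diagram. -/
def diagramAut (h : D.IsDiagramAut σ) : Uq D q ≃ₐ[ℂ] Uq D q :=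
  AlgEquiv.ofAlgHom (diagramHom q h) (diagramHom q h.symm)
    (hom_ext fun g => by cases g <;> simp [diagramHom_gen, Gen.map])
    (hom_ext fun g => by cases g <;> simp [diagramHom_gen, Gen.map])

theorem diagramAut_gen (h : D.IsDiagramAut σ) (g : Gen I) :
    diagramAut q h (gen D q g) = gen D q (g.map σ) :=
  diagramHom_gen q h g

end Uq

/-! ### Weight spaces and characters -/

section Weights

variable {I : Type*} (D : CartanDatum I) (q : ℂ)
variable (V : Type*) [AddCommGroup V] [Module ℂ V] [Module (Uq D q) V]
  [IsScalarTower ℂ (Uq D q) V]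

/-- The subspace of vectors of weight `γ`, on which each `k_i` acts as `q_i ^ ⟨γ, α_i^∨⟩`. -/
def weightSpace (γ : D.Weight) : Submodule ℂ V where
  carrier := {v | ∀ i, Uq.k D q i • v = (q ^ D.d i) ^ γ i • v}
  zero_mem' := by simp
  add_mem' := by
    intro a b ha hb i
    rw [smul_add, smul_add, ha i, hb i]
  smul_mem' := by
    intro c a ha i
    rw [smul_comm, ha i, smul_comm]

variable {D q V} in
theorem mem_weightSpace {γ : D.Weight} {v : V} :
    v ∈ weightSpace D q V γ ↔ ∀ i, Uq.k D q i • v = (q ^ D.d i) ^ γ i • v :=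
  Iff.rfl

variable {q} in
theorem IsGenericParam.zpow_injective (hq : IsGenericParam q) {d : ℕ} (hd : 0 < d) :
    Function.Injective fun m : ℤ => (q ^ d) ^ m := by
  have h0 : q ^ d ≠ 0 := pow_ne_zero _ hq.1
  have key : ∀ n : ℕ, 0 < n → (q ^ d) ^ n ≠ 1 := fun n hn => by
    rw [← pow_mul]
    exact hq.2 _ (Nat.mul_pos hd hn)
  have aux : ∀ m n : ℤ, m < n → (q ^ d) ^ m ≠ (q ^ d) ^ n := fun m n hmn he => by
    apply key (n - m).toNat (by omega)
    rw [← zpow_natCast, Int.toNat_of_nonneg (by omega), zpow_sub₀ h0, he,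
      div_self (zpow_ne_zero _ h0)]
  intro m n h
  rcases lt_trichotomy m n with hmn | hmn | hmn
  · exact absurd h (aux m n hmn)
  · exact hmn
  · exact absurd h.symm (aux n m hmn)

variable {q} in
/-- A finite-dimensional module has finitely many weights. -/
theorem finite_weights [Finite I] [FiniteDimensional ℂ V] (hq : IsGenericParam q) :
    {γ : D.Weight | weightSpace D q V γ ≠ ⊥}.Finite := by
  let T : I → Module.End ℂ V := fun i => Algebra.lsmul ℂ ℂ V (Uq.k D q i)
  have hfin : (Set.univ.pi fun i => {μ : ℂ | (T i).HasEigenvalue μ}).Finite :=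
    Set.Finite.pi fun i => (T i).finite_hasEigenvalue
  refine Set.Finite.of_finite_image (f := fun γ i => (q ^ D.d i) ^ γ i)
    (hfin.subset ?_) ?_
  · rintro _ ⟨γ, hγ, rfl⟩ i -
    obtain ⟨v, hv, hv0⟩ := Submodule.exists_mem_ne_zero_of_ne_bot hγ
    exact Module.End.hasEigenvalue_of_hasEigenvector
      ⟨Module.End.mem_eigenspace_iff.mpr (hv i), hv0⟩
  · intro γ _ γ' _ h
    funext i
    exact hq.zpow_injective (D.d_pos i) (congrFun h i)

variable {q} in
/-- The character `∑_γ dim V_γ e^γ` of a finite-dimensional `U_q(𝔤)`-module, an element of the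
group ring of the weight lattice. -/
def character [Finite I] [FiniteDimensional ℂ V] (hq : IsGenericParam q) :
    AddMonoidAlgebra ℤ D.Weight :=
  .ofCoeff <| Finsupp.ofSupportFinite
    (fun γ => (Module.finrank ℂ (weightSpace D q V γ) : ℤ))
    ((finite_weights D V hq).subset fun γ hγ h0 => hγ (by simp [h0]))

/-- `V` has a highest weight vector of weight `lam`: a non-zero vector of weight `lam`
annihilated by all `e_i`. -/
def HasHighestWeight (lam : D.Weight) : Prop :=
  ∃ v ∈ weightSpace D q V lam, v ≠ 0 ∧ ∀ i, Uq.e D q i • v = 0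

end Weights

/-- A finite-dimensional representation of `U_q(𝔤)` that is the sum of its weight spaces with
respect to the integral weights. -/
structure FDRep {I : Type*} (D : CartanDatum I) (q : ℂ) where
  carrier : Type
  [addCommGroup : AddCommGroup carrier]
  [module : Module ℂ carrier]
  [moduleUq : Module (Uq D q) carrier]
  [isScalarTower : IsScalarTower ℂ (Uq D q) carrier]
  [finiteDimensional : FiniteDimensional ℂ carrier]
  iSup_weightSpace : ⨆ γ, weightSpace D q carrier γ = ⊤

attribute [instance] FDRep.addCommGroup FDRep.module FDRep.moduleUq FDRep.isScalarTower
  FDRep.finiteDimensional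

/-! ### Foldings -/

/-- A connected simply-laced Dynkin diagram of finite type (that of `𝔤'`) with an automorphism
`σ` such that two distinct nodes in the same `σ`-orbit are never adjacent. -/
structure FoldingDatum (I' : Type*) extends CartanDatum I' where
  connected : toCartanDatum.dynkinGraph.Connected
  simplyLaced : C.IsSimplyLaced
  d_eq_one : ∀ i, d i = 1
  σ : Equiv.Perm I'
  isDiagramAut : toCartanDatum.IsDiagramAut σ
  orbit_not_adj : ∀ i j, σ.SameCycle i j → i ≠ j → C i j = 0

namespace FoldingDatum

variable {I' : Type*} (F : FoldingDatum I')

/-- The set of `σ`-orbits, i.e. of nodes of the Dynkin diagrams of `𝔤` and `ᴸ𝔤`. -/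
def Orbit : Type _ := Quotient (Equiv.Perm.SameCycle.setoid F.σ)

/-- The orbit of a node. -/
def orb (i : I') : F.Orbit := Quotient.mk _ i

theorem orb_eq {i j : I'} : F.orb i = F.orb j ↔ F.σ.SameCycle i j := Quotient.eq

theorem orb_surjective : Function.Surjective F.orb := Quotient.mk_surjective

theorem orb_σ (i : I') : F.orb (F.σ i) = F.orb i :=
  F.orb_eq.2 (Equiv.Perm.sameCycle_apply_left.2 (Equiv.Perm.SameCycle.refl _ _))

instance [Finite I'] : Finite F.Orbit := Finite.of_surjective _ F.orb_surjective

/-- A function that is constant along `σ` is constant on orbits. -/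
theorem eq_of_orb_eq [Finite I'] {α : Type*} {f : I' → α} (hf : ∀ i, f (F.σ i) = f i) {i j : I'}
    (h : F.orb i = F.orb j) : f i = f j := by
  obtain ⟨n, hn⟩ := (F.orb_eq.1 h).exists_nat_pow_eq
  rw [← hn]
  clear hn
  induction n with
  | zero => rfl
  | succ n ih => rw [pow_succ', Equiv.Perm.mul_apply, hf, ih]

theorem C_symm (i j : I') : F.C i j = F.C j i := by
  have := F.posDef.isHermitian.apply i j
  simp only [Matrix.of_apply, F.d_eq_one, star_trivial] at this
  simpa using this.symm

section Langlands

variable [Fintype I']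

open scoped Classical in
/-- The nodes in a given orbit. -/
def fibre (J : F.Orbit) : Finset I' := Finset.univ.filter fun i => F.orb i = J

theorem mem_fibre {J : F.Orbit} {i : I'} : i ∈ F.fibre J ↔ F.orb i = J := by
  simp [fibre]

theorem sum_fibre_σ (J : F.Orbit) (j : I') :
    ∑ i ∈ F.fibre J, F.C i (F.σ j) = ∑ i ∈ F.fibre J, F.C i j := by
  symm
  refine Finset.sum_equiv F.σ (fun i => ?_) (fun i _ => (F.isDiagramAut.1 i j).symm)
  rw [mem_fibre, mem_fibre, orb_σ]

/-- The Cartan matrix of `𝔤 = (𝔤')^σ`: the coroot attached to an orbit is the sum of the coroots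
of `𝔤'` in it, and the simple root is the common restriction of the simple roots of `𝔤'` in it,
so that `C_{IJ} = ∑_{i ∈ I} C'_{ij}` for any `j ∈ J`. -/
def foldedCartan : Matrix F.Orbit F.Orbit ℤ :=
  Matrix.of fun I J => Quotient.lift (fun j => ∑ i ∈ F.fibre I, F.C i j)
    (fun _ _ h => F.eq_of_orb_eq (f := fun j => ∑ i ∈ F.fibre I, F.C i j)
      (F.sum_fibre_σ I) (Quotient.sound h)) J

theorem foldedCartan_orb (I : F.Orbit) (j : I') :
    F.foldedCartan I (F.orb j) = ∑ i ∈ F.fibre I, F.C i j := rfl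

theorem sum_orbit [Fintype F.Orbit] (f : I' → ℝ) :
    ∑ I : F.Orbit, ∑ i ∈ F.fibre I, f i = ∑ i, f i := by
  classical
  simp only [fibre]
  convert Finset.sum_fiberwise (s := Finset.univ) (g := F.orb) (f := f)

theorem card_mul_foldedCartan (I J : F.Orbit) :
    ((F.fibre I).card : ℝ) * (F.foldedCartan J I : ℝ) =
      ∑ i ∈ F.fibre I, ∑ j ∈ F.fibre J, (F.C i j : ℝ) := by
  have : ∀ i ∈ F.fibre I, ∑ j ∈ F.fibre J, (F.C i j : ℝ) = (F.foldedCartan J I : ℝ) := by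
    intro i hi
    rw [← F.mem_fibre.1 hi, foldedCartan_orb]
    push_cast
    exact Finset.sum_congr rfl fun j _ => by rw [F.C_symm]
  rw [Finset.sum_congr rfl this, Finset.sum_const, nsmul_eq_mul]

theorem quadForm_eq (x : F.Orbit → ℝ) [Fintype F.Orbit] :
    ∑ I, ∑ J, x I * (((F.fibre I).card : ℝ) * (F.foldedCartan J I : ℝ)) * x J =
      ∑ i, ∑ j, x (F.orb i) * (F.C i j : ℝ) * x (F.orb j) := by
  rw [← F.sum_orbit fun i => ∑ j, x (F.orb i) * (F.C i j : ℝ) * x (F.orb j)]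
  refine Finset.sum_congr rfl fun I _ => ?_
  have : ∀ i ∈ F.fibre I, ∑ j, x (F.orb i) * (F.C i j : ℝ) * x (F.orb j) =
      ∑ J, ∑ j ∈ F.fibre J, x I * (F.C i j : ℝ) * x J := by
    intro i hi
    rw [← F.sum_orbit fun j => x (F.orb i) * (F.C i j : ℝ) * x (F.orb j)]
    refine Finset.sum_congr rfl fun J _ => Finset.sum_congr rfl fun j hj => ?_
    rw [F.mem_fibre.1 hi, F.mem_fibre.1 hj]
  rw [Finset.sum_congr rfl this, Finset.sum_comm]
  refine Finset.sum_congr rfl fun J _ => ?_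
  rw [F.card_mul_foldedCartan, Finset.mul_sum, Finset.sum_mul]
  refine Finset.sum_congr rfl fun i _ => ?_
  rw [Finset.mul_sum, Finset.sum_mul]

/-- The Cartan datum of the Langlands dual Lie algebra `ᴸ𝔤`: its Cartan matrix is the transpose
of that of `𝔤`, and half the square length of a simple root is proportional to the size of the
orbit. -/
def langlandsDual : CartanDatum F.Orbit where
  C := F.foldedCartan.transpose
  d I := (F.fibre I).card
  C_diag I := by
    obtain ⟨i, rfl⟩ := F.orb_surjective I
    rw [Matrix.transpose_apply, foldedCartan_orb,
      Finset.sum_eq_single_of_mem i (F.mem_fibre.2 rfl), F.C_diag]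
    intro j hj hji
    exact F.orbit_not_adj j i (F.orb_eq.1 (F.mem_fibre.1 hj)) hji
  C_nonpos I J hIJ := by
    obtain ⟨i, rfl⟩ := F.orb_surjective I
    rw [Matrix.transpose_apply, foldedCartan_orb]
    refine Finset.sum_nonpos fun j hj => F.C_nonpos j i ?_
    rintro rfl
    exact hIJ (F.mem_fibre.1 hj)
  d_pos I := by
    obtain ⟨i, rfl⟩ := F.orb_surjective I
    exact Finset.card_pos.2 ⟨i, F.mem_fibre.2 rfl⟩
  posDef := by
    classical
    have : Fintype F.Orbit := Fintype.ofFinite _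
    refine Matrix.PosDef.of_dotProduct_mulVec_pos (Matrix.IsHermitian.ext fun I J => ?_)
      fun x hx => ?_
    · simp only [Matrix.of_apply, Matrix.transpose_apply, star_trivial]
      rw [F.card_mul_foldedCartan, F.card_mul_foldedCartan, Finset.sum_comm]
      exact Finset.sum_congr rfl fun i _ => Finset.sum_congr rfl fun j _ => by rw [F.C_symm]
    · have hy : (fun i => x (F.orb i)) ≠ 0 := fun h => hx <| funext fun J => by
        obtain ⟨i, rfl⟩ := F.orb_surjective J
        exact congrFun h i
      have h1 := F.posDef.dotProduct_mulVec_pos hy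
      have h2 := F.quadForm_eq x
      simp only [dotProduct, Matrix.mulVec, Matrix.of_apply, Matrix.transpose_apply, star_trivial,
        Pi.star_apply, F.d_eq_one, Nat.cast_one, one_mul, Finset.mul_sum] at h1 ⊢
      simp only [← mul_assoc] at h1 h2 ⊢
      rw [h2]
      exact h1

end Langlands

/-! ### `σ`-invariant weights -/

/-- The lattice of `σ`-invariant weights of `𝔤'`. -/
def invWeights : AddSubgroup F.Weight where
  carrier := {γ | ∀ i, γ (F.σ i) = γ i}
  zero_mem' := fun _ => rfl
  add_mem' := fun {a b} ha hb i => by simp [ha i, hb i]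
  neg_mem' := fun {a} ha i => by simp [ha i]

/-- The isomorphism between the lattice of weights of `ᴸ𝔤` and that of `σ`-invariant weights of
`𝔤'`; it sends the fundamental weight of an orbit to the sum of the fundamental weights of `𝔤'`
in this orbit. -/
def weightEquiv [Fintype I'] : F.langlandsDual.Weight ≃+ F.invWeights where
  toFun γ := ⟨fun i => γ (F.orb i), fun i => congrArg γ (F.orb_σ i)⟩
  invFun γ := fun J => Quotient.lift (fun i => γ.1 i)
    (fun _ _ h => F.eq_of_orb_eq (f := γ.1) γ.2 (Quotient.sound h)) J
  left_inv γ := by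
    funext J
    obtain ⟨i, rfl⟩ := F.orb_surjective J
    rfl
  right_inv γ := rfl
  map_add' _ _ := rfl

/-! ### The subspace `W^σ` -/

section Fixed

variable (q : ℂ)
variable {W : Type*} [AddCommGroup W] [Module ℂ W] [Module (Uq F.toCartanDatum q) W]
  [IsScalarTower ℂ (Uq F.toCartanDatum q) W]

/-- `s` is the operator `σ̂` on a module `W` of highest weight `lam`: it intertwines `W` with its
twist by `σ`, and is the identity on the highest weight subspace. -/
def IsSigmaHat (lam : F.Weight) (s : W ≃ₗ[ℂ] W) : Prop :=
  (∀ (g : Uq F.toCartanDatum q) (w : W),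
    Uq.diagramAut q F.isDiagramAut g • w = s (g • s.symm w)) ∧
  ∀ w ∈ weightSpace F.toCartanDatum q W lam, s w = w

/-- `W^σ`, the span of all weight vectors fixed by `σ̂`. -/
def fixedPart (s : W ≃ₗ[ℂ] W) : Submodule ℂ W :=
  Submodule.span ℂ {w | s w = w ∧ ∃ γ : F.Weight, w ∈ weightSpace F.toCartanDatum q W γ}

/-- The component of `W^σ` of `σ`-invariant weight corresponding to the `ᴸ𝔤`-weight `γ`. -/
def fixedWeightSpace [Fintype I'] (s : W ≃ₗ[ℂ] W) (γ : F.langlandsDual.Weight) :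
    Submodule ℂ W :=
  F.fixedPart q s ⊓ weightSpace F.toCartanDatum q W (F.weightEquiv γ)

theorem mem_fixedWeightSpace [Fintype I'] {s : W ≃ₗ[ℂ] W} {γ : F.langlandsDual.Weight} {w : W} :
    w ∈ F.fixedWeightSpace q s γ ↔
      s w = w ∧ w ∈ weightSpace F.toCartanDatum q W (F.weightEquiv γ) := by
  constructor
  · rintro ⟨h1, h2⟩
    refine ⟨?_, h2⟩
    have : F.fixedPart q s ≤ LinearMap.eqLocus (s : W →ₗ[ℂ] W) LinearMap.id :=
      Submodule.span_le.2 fun w hw => hw.1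
    exact this h1
  · rintro ⟨h1, h2⟩
    exact ⟨Submodule.subset_span ⟨h1, _, h2⟩, h2⟩

variable {q} in
/-- The character `χ(W^σ) = ∑_γ dim W^σ_γ e^γ`, in the group ring of the weight lattice of
`ᴸ𝔤`. -/
def fixedCharacter [Fintype I'] [FiniteDimensional ℂ W] (hq : IsGenericParam q)
    (s : W ≃ₗ[ℂ] W) : AddMonoidAlgebra ℤ F.langlandsDual.Weight :=
  .ofCoeff <| Finsupp.ofSupportFinite
    (fun γ => (Module.finrank ℂ (F.fixedWeightSpace q s γ) : ℤ))
    (((finite_weights F.toCartanDatum W hq).preimage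
      (f := fun γ : F.langlandsDual.Weight => (F.weightEquiv γ : F.Weight))
      (Subtype.val_injective.comp F.weightEquiv.injective).injOn).subset
        fun γ hγ h0 => hγ (by
          have : F.fixedWeightSpace q s γ = ⊥ := by
            rw [eq_bot_iff, ← h0]; exact inf_le_right
          simp [this]))

end Fixed

end FoldingDatum

end FoldedQG

end

/-!
The operator `σ̂` sends `g • v` to `σ(g) • v`, where `v` is a highest weight vector; the point is that
this is well defined (`diagramAut_smul_eq_zero`). In the sum of `W` and its twist by `σ`, the
submodule generated by `(v, v)` is spanned by the vectors obtained by applying words in the `f i`,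
so that a functional comparing the coefficients of `v` in the two components vanishes on it. If
`g • v = 0` and `σ(g) • v ≠ 0`, then this submodule would contain `(0, v)`.

The identification of `ᴸP` with `P^σ` turns the simple reflection of an orbit `J` into the product of
the commuting reflections in the nodes of `J` (`weightEquiv_simpleReflection`). If an invariant weight
`γ` has value `-n ≤ 0` on the nodes of `J`, the product of the `(e i) ^ n` over `i ∈ J` is injective on
the weight space of `γ`, by the theory of quantum `sl₂` (`IsQuantumSl2.eq_zero_of_pow_raise_eq_zero`),
and takes it to the weight space of the reflected weight. Since the `e i` with `i ∈ J` commute and are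
permuted by `σ`, the product commutes with `σ̂` and hence maps fixed vectors to fixed vectors; for
positive values the `f i` take the place of the `e i`. Both inequalities between the dimensions
together give the invariance of the character (`coeff_fixedCharacter_simpleReflection`).

An invariant element of the group ring is a virtual character once every dominant weight `μ` is the
highest weight, with multiplicity one, of some finite-dimensional representation: multiples of the
characters of these representations are subtracted, starting from the highest weights
(`mem_virtualCharacters_of_invariant`). The representation is constructed without the triangular
decomposition of the quantum group. The operators `f i` act on the space of all words in the index
set by adding a letter, and the commutation relations determine operators `e i`, `k i` satisfying all
relations except those of Serre (`freePreSerreRelations`). Dividing by the largest stable subspace on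
which the coefficient of the empty word vanishes gives a simple module. The Serre elements in the
`f i` commute with all `e i` even before the Serre relations are imposed
(`PreSerreRelations.commute_serreElement_f`), so they generate stable subspaces without component
along the empty word and act by zero; similarly for the `e i`. On this simple module the `f i` are
locally nilpotent, so that its weights which are negative on a coroot can be reflected upwards, and
therefore no weight is longer than `μ` with respect to the Weyl group invariant form
(`IsSimpleHighestWeight.sqLength_le`). As the weight lattice is discrete, the module is
finite-dimensional.
-/

namespace FoldedQG

/-! ### Quantum integers and binomial coefficients -/

theorem IsGenericParam.pow {q : ℂ} (hq : IsGenericParam q) {d : ℕ} (hd : 0 < d) :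
    IsGenericParam (q ^ d) :=
  ⟨pow_ne_zero _ hq.1, fun n hn => by rw [← pow_mul]; exact hq.2 _ (Nat.mul_pos hd hn)⟩

theorem IsGenericParam.zpow_inj {q : ℂ} (hq : IsGenericParam q) {m n : ℤ} :
    q ^ m = q ^ n ↔ m = n := by
  constructor
  · intro h
    have := hq.zpow_injective (d := 1) one_pos
    simp only [pow_one] at this
    exact this h
  · rintro rfl; rfl

theorem IsGenericParam.sub_inv_ne_zero {q : ℂ} (hq : IsGenericParam q) : q - q⁻¹ ≠ 0 := by
  intro h
  have : q ^ (1 : ℤ) = q ^ (-1 : ℤ) := by simpa [sub_eq_zero] using h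
  have := hq.zpow_inj.1 this
  omega

/-- The quantum integer `[m]_q` for an arbitrary integer `m`. -/
noncomputable def qIntZ (q : ℂ) (m : ℤ) : ℂ := (q ^ m - q ^ (-m)) / (q - q⁻¹)

theorem qIntZ_natCast (q : ℂ) (n : ℕ) : qIntZ q n = qInt q n := rfl

theorem qIntZ_neg (q : ℂ) (m : ℤ) : qIntZ q (-m) = -qIntZ q m := by
  simp only [qIntZ, neg_neg]; ring

@[simp] theorem qIntZ_zero (q : ℂ) : qIntZ q 0 = 0 := by simp [qIntZ]

theorem qIntZ_ne_zero {q : ℂ} (hq : IsGenericParam q) {m : ℤ} (hm : m ≠ 0) : qIntZ q m ≠ 0 := by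
  refine div_ne_zero (fun h => hm ?_) hq.sub_inv_ne_zero
  have := hq.zpow_inj.1 (sub_eq_zero.1 h)
  omega

theorem qInt_ne_zero {q : ℂ} (hq : IsGenericParam q) {n : ℕ} (hn : n ≠ 0) : qInt q n ≠ 0 := by
  rw [← qIntZ_natCast]; exact qIntZ_ne_zero hq (by exact_mod_cast hn)

@[simp] theorem qInt_zero (q : ℂ) : qInt q 0 = 0 := by simp [qInt]

theorem qInt_inv (q : ℂ) (n : ℕ) : qInt q⁻¹ n = qInt q n := by
  simp only [qInt, inv_zpow', neg_neg, inv_inv]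
  rw [← neg_sub q q⁻¹, div_neg, ← neg_div, neg_sub]

theorem qFactorial_inv (q : ℂ) (n : ℕ) : qFactorial q⁻¹ n = qFactorial q n := by
  simp only [qFactorial, qInt_inv]

theorem qBinom_inv (q : ℂ) (n r : ℕ) : qBinom q⁻¹ n r = qBinom q n r := by
  simp only [qBinom, qFactorial_inv]

theorem IsGenericParam.inv {q : ℂ} (hq : IsGenericParam q) : IsGenericParam q⁻¹ :=
  ⟨inv_ne_zero hq.1, fun n hn h => hq.2 n hn (by simpa using h)⟩

theorem qFactorial_succ (q : ℂ) (n : ℕ) :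
    qFactorial q (n + 1) = qFactorial q n * qInt q (n + 1) := by
  simp [qFactorial, Finset.prod_range_succ]

theorem qFactorial_ne_zero {q : ℂ} (hq : IsGenericParam q) (n : ℕ) : qFactorial q n ≠ 0 :=
  Finset.prod_ne_zero_iff.2 fun _ _ => qInt_ne_zero hq (by omega)

theorem qBinom_zero_right {q : ℂ} (hq : IsGenericParam q) (n : ℕ) : qBinom q n 0 = 1 := by
  have := qFactorial_ne_zero hq n
  simpa [qBinom, qFactorial] using this

theorem qBinom_self {q : ℂ} (hq : IsGenericParam q) (n : ℕ) : qBinom q n n = 1 := by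
  have := qFactorial_ne_zero hq n
  simpa [qBinom, qFactorial] using this

theorem qBinom_mul_qInt {q : ℂ} (hq : IsGenericParam q) {n r : ℕ} (hr : r < n) :
    qBinom q n r * qInt q (n - r) = qBinom q n (r + 1) * qInt q (r + 1) := by
  obtain ⟨m, rfl⟩ := Nat.exists_eq_add_of_lt hr
  have h1 : r + m + 1 - r = m + 1 := by omega
  have h2 : r + m + 1 - (r + 1) = m := by omega
  simp only [qBinom, h1, h2, qFactorial_succ q r, qFactorial_succ q m]
  have := qFactorial_ne_zero hq r
  have := qFactorial_ne_zero hq m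
  have := qInt_ne_zero hq (n := m + 1) (by omega)
  have := qInt_ne_zero hq (n := r + 1) (by omega)
  field_simp

theorem qInt_add {q : ℂ} (hq : IsGenericParam q) (a b : ℕ) :
    qInt q (a + b) = q ^ (a : ℤ) * qInt q b + q ^ (-(b : ℤ)) * qInt q a := by
  have h := hq.sub_inv_ne_zero
  have h0 := hq.1
  simp only [qInt]
  push_cast
  simp only [mul_div_assoc', ← add_div, neg_add, zpow_add₀ h0, zpow_neg]
  congr 1
  have : q ^ (a : ℤ) ≠ 0 := zpow_ne_zero _ h0
  have : q ^ (b : ℤ) ≠ 0 := zpow_ne_zero _ h0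
  field_simp
  ring

/-- The quantum Pascal rule. -/
theorem qBinom_succ_succ {q : ℂ} (hq : IsGenericParam q) {n r : ℕ} (hr : r < n) :
    qBinom q (n + 1) (r + 1) =
      q ^ (r + 1 : ℤ) * qBinom q n (r + 1) + q ^ (-(n - r : ℤ)) * qBinom q n r := by
  obtain ⟨m, rfl⟩ := Nat.exists_eq_add_of_lt hr
  have h1 : r + m + 1 - r = m + 1 := by omega
  have h2 : r + m + 1 - (r + 1) = m := by omega
  have h3 : r + m + 1 + 1 - (r + 1) = m + 1 := by omega
  simp only [qBinom, h1, h2, h3, qFactorial_succ q r, qFactorial_succ q m,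
    qFactorial_succ q (r + m + 1)]
  have e : r + m + 1 + 1 = (r + 1) + (m + 1) := by omega
  rw [e, qInt_add hq]
  have := qFactorial_ne_zero hq r
  have := qFactorial_ne_zero hq m
  have := qInt_ne_zero hq (n := m + 1) (by omega)
  have := qInt_ne_zero hq (n := r + 1) (by omega)
  have e2 : -(((r + m + 1 : ℕ) : ℤ) - (r : ℤ)) = -((m + 1 : ℕ) : ℤ) := by push_cast; ring
  rw [e2]
  push_cast
  field_simp

/-- A special value of the quantum binomial theorem. -/
theorem sum_qBinom_eq_zero {q : ℂ} (hq : IsGenericParam q) (n : ℕ) :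
    ∑ r ∈ Finset.range (n + 2), (-1) ^ r * qBinom q (n + 1) r * (q ^ (n : ℤ)) ^ r = 0 := by
  have h0 := hq.1
  -- By the Pascal rule the sum telescopes.
  let G : ℕ → ℂ := fun r => if r = 0 ∨ r = n + 2 then 0 else
    (-1) ^ (r + 1) * (qBinom q n (r - 1) * q ^ ((n + 1) * (r - 1) : ℤ))
  have key : ∀ r ∈ Finset.range (n + 2),
      (-1) ^ r * qBinom q (n + 1) r * (q ^ (n : ℤ)) ^ r = G (r + 1) - G r := by
    intro r hr
    rw [Finset.mem_range] at hr
    rw [← zpow_natCast (q ^ (n : ℤ)) r, ← zpow_mul]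
    rcases r with _ | r
    · by_cases hn : n = 0
      · subst hn; simp [G, qBinom_zero_right hq]
      · simp [G, qBinom_zero_right hq]
    · by_cases hrn : r = n
      · subst hrn
        simp only [G, qBinom_self hq]
        simp [qBinom_self hq]
        rw [pow_succ (-1 : ℂ) (r + 1)]
        ring_nf
      · rw [qBinom_succ_succ hq (by omega)]
        have e1 : ¬ (r + 1 = 0 ∨ r + 1 = n + 2) := by omega
        have e2 : ¬ (r + 1 + 1 = 0 ∨ r + 1 + 1 = n + 2) := by omega
        simp only [G, e1, e2, if_false, Nat.add_sub_cancel]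
        have a1 : q ^ ((n + 1) * (((r + 1 + 1 : ℕ) : ℤ) - 1) : ℤ) =
            q ^ (r + 1 : ℤ) * q ^ (n * ((r + 1 : ℕ) : ℤ) : ℤ) := by
          rw [← zpow_add₀ h0]; congr 1; push_cast; ring
        have a2 : q ^ ((n + 1) * (((r + 1 : ℕ) : ℤ) - 1) : ℤ) =
            q ^ (-(n - r : ℤ)) * q ^ (n * ((r + 1 : ℕ) : ℤ) : ℤ) := by
          rw [← zpow_add₀ h0]; congr 1; push_cast; ring
        rw [a1, a2, pow_succ (-1 : ℂ) (r + 1 + 1), pow_succ (-1 : ℂ) (r + 1)]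
        ring
  rw [Finset.sum_congr rfl key, Finset.sum_range_sub]
  simp [G]

/-! ### Serre elements commute with the opposite generators -/

section Serre

variable {A : Type*} [Ring A] [Algebra ℂ A]

/-- Replacing `y` in a Serre element of degree `n + 1` by an element `K` that commutes with `x` up to
the scalar `Q ^ n` gives zero, by the quantum binomial theorem. -/
theorem serreElement_eq_zero_of_comm {Q : ℂ} (hQ : IsGenericParam Q) (n : ℕ) {x K : A}
    (h : K * x = (Q ^ (n : ℤ)) • (x * K)) : serreElement Q (n + 1) x K = 0 := by
  have hK : ∀ r : ℕ, K * x ^ r = ((Q ^ (n : ℤ)) ^ r) • (x ^ r * K) := by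
    intro r
    induction r with
    | zero => simp
    | succ r ih =>
      rw [pow_succ x, ← mul_assoc, ih, smul_mul_assoc, mul_assoc, h, mul_smul_comm, smul_smul,
        ← pow_succ, mul_assoc]
  have : ∀ r ∈ Finset.range (n + 1 + 1), ((-1) ^ r * qBinom Q (n + 1) r) •
      (x ^ (n + 1 - r) * K * x ^ r) =
      ((-1) ^ r * qBinom Q (n + 1) r * (Q ^ (n : ℤ)) ^ r) • (x ^ (n + 1) * K) := by
    intro r hr
    rw [Finset.mem_range] at hr
    rw [mul_assoc, hK, mul_smul_comm, smul_smul, ← mul_assoc, ← pow_add,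
      Nat.sub_add_cancel (by omega)]
  rw [serreElement, Finset.sum_congr rfl this, ← Finset.sum_smul, sum_qBinom_eq_zero hQ, zero_smul]

theorem serreElement_inv (Q : ℂ) (n : ℕ) (x y : A) :
    serreElement Q⁻¹ n x y = serreElement Q n x y := by
  simp only [serreElement, qBinom_inv]

theorem serreElement_sub (Q : ℂ) (n : ℕ) (x y z : A) :
    serreElement Q n x (y - z) = serreElement Q n x y - serreElement Q n x z := by
  simp only [serreElement, mul_sub, sub_mul, smul_sub, Finset.sum_sub_distrib]

theorem serreElement_smul (Q : ℂ) (n : ℕ) (x y : A) (c : ℂ) :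
    serreElement Q n x (c • y) = c • serreElement Q n x y := by
  simp only [serreElement, Finset.smul_sum, mul_smul_comm, smul_mul_assoc]
  exact Finset.sum_congr rfl fun r _ => smul_comm _ _ _

theorem mul_serreElement_of_commute {E x : A} (Q : ℂ) (n : ℕ) (y : A) (h : E * x = x * E) :
    E * serreElement Q n x y - serreElement Q n x y * E =
      serreElement Q n x (E * y - y * E) := by
  have hE : ∀ r : ℕ, E * x ^ r = x ^ r * E := fun r => (Commute.pow_right h r)
  simp only [serreElement_sub]
  simp only [serreElement, Finset.mul_sum, Finset.sum_mul]
  congr 1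
  · refine Finset.sum_congr rfl fun r _ => ?_
    rw [mul_smul_comm, ← mul_assoc, ← mul_assoc, hE, mul_assoc (x ^ _) E]
  · refine Finset.sum_congr rfl fun r _ => ?_
    rw [smul_mul_assoc, mul_assoc, ← hE, ← mul_assoc, ← mul_assoc]

/-- The commutator of a raising operator with the Serre element built from the corresponding
lowering operator `x` vanishes: the commutator is a telescoping sum. -/
theorem commute_serreElement_of_raising {Q : ℂ} (hQ : IsGenericParam Q) (N : ℕ)
    {E x y K K' : A}
    (hx : K * x = Q ^ (-2 : ℤ) • (x * K)) (hx' : K' * x = Q ^ (2 : ℤ) • (x * K'))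
    (hy : K * y = Q ^ (N : ℤ) • (y * K)) (hy' : K' * y = Q ^ (-N : ℤ) • (y * K'))
    (hEx : E * x - x * E = (Q - Q⁻¹)⁻¹ • (K - K')) (hEy : E * y = y * E) :
    E * serreElement Q (N + 1) x y = serreElement Q (N + 1) x y * E := by
  have h0 := hQ.1
  have hs := hQ.sub_inv_ne_zero
  -- `B c` is the element usually denoted `[K; c]`.
  let B : ℤ → A := fun c => (Q - Q⁻¹)⁻¹ • (Q ^ c • K - Q ^ (-c) • K')
  have Bx : ∀ c, B c * x = x * B (c - 2) := by
    intro c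
    simp only [B, smul_mul_assoc, sub_mul, hx, hx', mul_smul_comm, mul_sub, smul_smul,
      ← zpow_add₀ h0]
    (congr 4; all_goals ring)
  have By : ∀ c, B c * y = y * B (c + N) := by
    intro c
    simp only [B, smul_mul_assoc, sub_mul, hy, hy', mul_smul_comm, mul_sub, smul_smul,
      ← zpow_add₀ h0]
    congr 4; ring
  have Bxr : ∀ (r : ℕ) c, B c * x ^ r = x ^ r * B (c - 2 * r) := by
    intro r
    induction r with
    | zero => intro c; simp
    | succ r ih =>
      intro c
      rw [pow_succ, ← mul_assoc, ih, mul_assoc, Bx, ← mul_assoc]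
      congr 2; push_cast; ring
  have Ex : ∀ m : ℕ, E * x ^ m = x ^ m * E + qInt Q m • (x ^ (m - 1) * B (1 - m)) := by
    intro m
    induction m with
    | zero => simp
    | succ m ih =>
      have e1 : E * x = x * E + B 0 := by
        rw [sub_eq_iff_eq_add] at hEx
        rw [hEx, add_comm]; simp [B]
      have e2 : x ^ (m - 1) * B (1 - m) * x = x ^ m * B (-1 - m) ∨ m = 0 := by
        rcases m with _ | m
        · right; rfl
        · left
          rw [mul_assoc, Bx, ← mul_assoc, ← pow_succ, Nat.add_sub_cancel]
          congr 2; push_cast; ring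
      have e3 : qInt Q m • (x ^ (m - 1) * B (1 - m) * x) =
          qInt Q m • (x ^ m * B (-1 - m)) := by
        rcases e2 with e2 | rfl
        · rw [e2]
        · simp
      rw [pow_succ, ← mul_assoc, ih, add_mul, smul_mul_assoc, e3, mul_assoc, e1, mul_add, add_assoc,
        ← mul_assoc, Nat.add_sub_cancel, ← mul_smul_comm, ← mul_add, ← mul_smul_comm]
      congr 2
      simp only [B, smul_smul, smul_sub]
      rw [sub_add_sub_comm, ← add_smul, ← add_smul]
      have hm : Q ^ (m : ℤ) ≠ 0 := zpow_ne_zero _ h0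
      congr 2
      · simp only [qInt]
        push_cast
        simp only [neg_add, zpow_add₀ h0, zpow_sub₀ h0, zpow_neg, zpow_one, zpow_zero,
          sub_add_cancel_right]
        field_simp
        ring
      · simp only [qInt]
        push_cast
        simp only [neg_add, zpow_add₀ h0, zpow_sub₀ h0, zpow_neg, zpow_one, neg_sub, zpow_zero,
          sub_add_cancel_right]
        field_simp
        ring
  -- The value of `c` beyond `N + 1` is set to zero since `qBinom` is not zero there.
  let c : ℕ → ℂ := fun r => if r ≤ N + 1 then qBinom Q (N + 1) r * qInt Q r else 0
  have hc : ∀ r ≤ N + 1, qBinom Q (N + 1) r * qInt Q (N + 1 - r : ℕ) = c (r + 1) := by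
    intro r hr
    rcases hr.lt_or_eq with h | rfl
    · simp only [c, if_pos (Nat.succ_le_of_lt h)]
      exact qBinom_mul_qInt hQ h
    · simp [c]
  -- The commutator with the `r`-th term of the Serre element is `H (r + 1) - H r`.
  let H : ℕ → A := fun r => ((-1) ^ (r + 1) * c r) •
    (x ^ (N + 1 - r) * y * x ^ (r - 1) * B (1 - r))
  have key : ∀ r ∈ Finset.range (N + 1 + 1),
      E * (((-1) ^ r * qBinom Q (N + 1) r) • (x ^ (N + 1 - r) * y * x ^ r)) -
        (((-1) ^ r * qBinom Q (N + 1) r) • (x ^ (N + 1 - r) * y * x ^ r)) * E =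
      H (r + 1) - H r := by
    intro r hr
    rw [Finset.mem_range] at hr
    have hr' : r ≤ N + 1 := by omega
    have e1 : E * (x ^ (N + 1 - r) * y * x ^ r) - x ^ (N + 1 - r) * y * x ^ r * E =
        qInt Q (N + 1 - r : ℕ) • (x ^ (N - r) * y * x ^ r * B (-r)) +
        qInt Q r • (x ^ (N + 1 - r) * y * x ^ (r - 1) * B (1 - r)) := by
      have : E * (x ^ (N + 1 - r) * y * x ^ r) = (E * x ^ (N + 1 - r)) * y * x ^ r := by
        simp only [mul_assoc]
      rw [this, Ex, add_mul, add_mul]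
      have t1 : x ^ (N + 1 - r) * E * y * x ^ r = x ^ (N + 1 - r) * y * x ^ r * E +
          qInt Q r • (x ^ (N + 1 - r) * y * x ^ (r - 1) * B (1 - r)) := by
        rw [mul_assoc _ E, hEy, ← mul_assoc, mul_assoc _ E, Ex, mul_add, mul_smul_comm]
        simp only [mul_assoc]
      have t2 : x ^ (N + 1 - r - 1) * B (1 - (N + 1 - r : ℕ)) * y * x ^ r =
          x ^ (N - r) * y * x ^ r * B (-r) := by
        rw [mul_assoc _ (B _), By, ← mul_assoc, mul_assoc _ (B _), Bxr, ← mul_assoc]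
        have t3 : N + 1 - r - 1 = N - r := by omega
        have t4 : (1 - ((N + 1 - r : ℕ) : ℤ) + N - 2 * r) = -r := by push_cast [hr']; ring
        rw [t3, t4]
      rw [t1, smul_mul_assoc, smul_mul_assoc, t2]
      abel
    rw [mul_smul_comm, smul_mul_assoc, ← smul_sub, e1, smul_add, smul_smul, smul_smul,
      mul_assoc _ (qBinom Q (N + 1) r) (qInt Q (N + 1 - r : ℕ)), hc r hr', sub_eq_add_neg (H (r + 1))]
    have hH1 : H (r + 1) = ((-1) ^ r * c (r + 1)) • (x ^ (N - r) * y * x ^ r * B (-r)) := by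
      have : (1 - ((r + 1 : ℕ) : ℤ)) = -r := by push_cast; ring
      simp only [H, this, Nat.add_sub_add_right, Nat.add_sub_cancel]
      congr 1; ring
    have hH2 : -H r = ((-1) ^ r * qBinom Q (N + 1) r * qInt Q r) •
        (x ^ (N + 1 - r) * y * x ^ (r - 1) * B (1 - r)) := by
      simp only [H, c, if_pos hr', ← neg_smul]
      congr 1
      ring
    rw [hH1, hH2]
  rw [← sub_eq_zero, serreElement, Finset.mul_sum, Finset.sum_mul, ← Finset.sum_sub_distrib,
    Finset.sum_congr rfl key, Finset.sum_range_sub]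
  simp [H, c]

end Serre

/-! ### The relations of a quantum group without the Serre relations -/

namespace CartanDatum

variable {I : Type*} (D : CartanDatum I)

theorem d_mul_C_symm (i j : I) : (D.d i : ℤ) * D.C i j = D.d j * D.C j i := by
  have := D.posDef.isHermitian.apply i j
  simp only [Matrix.of_apply, star_trivial] at this
  exact_mod_cast this.symm

theorem qPow_symm {q : ℂ} (i j : I) : (q ^ D.d i) ^ D.C i j = (q ^ D.d j) ^ D.C j i := by
  rw [← zpow_natCast, ← zpow_natCast, ← zpow_mul, ← zpow_mul, D.d_mul_C_symm]

theorem simpleReflection_apply (i : I) (γ : D.Weight) :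
    D.simpleReflection i γ = γ - γ i • D.simpleRoot i := by
  rfl

theorem simpleReflection_simpleReflection (i : I) (γ : D.Weight) :
    D.simpleReflection i (D.simpleReflection i γ) = γ := by
  exact Module.involutive_reflection (R := ℤ) (M := D.Weight) (x := D.simpleRoot i)
    (f := LinearMap.proj i) (D.C_diag i) γ

end CartanDatum

/-- Elements `e i`, `f i`, `k i`, `k' i` of an algebra satisfying all Drinfeld--Jimbo relations
except the quantum Serre relations. -/
structure PreSerreRelations {I : Type*} (D : CartanDatum I) (q : ℂ) {A : Type*} [Ring A]
    [Algebra ℂ A] (e f k k' : I → A) : Prop where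
  k_kinv i : k i * k' i = 1
  kinv_k i : k' i * k i = 1
  k_k i j : k i * k j = k j * k i
  k_e i j : k i * e j = (q ^ D.d i) ^ (D.C i j) • (e j * k i)
  k_f i j : k i * f j = (q ^ D.d i) ^ (-D.C i j) • (f j * k i)
  e_f i : e i * f i - f i * e i = (q ^ D.d i - (q ^ D.d i)⁻¹)⁻¹ • (k i - k' i)
  e_f_ne i j : i ≠ j → e i * f j = f j * e i

namespace PreSerreRelations

variable {I : Type*} {D : CartanDatum I} {q : ℂ} {A : Type*} [Ring A] [Algebra ℂ A]
  {e f k k' : I → A}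

theorem comm_inv {x K K' : A} {c : ℂ} (hc : c ≠ 0) (h1 : K * K' = 1) (h2 : K' * K = 1)
    (h : K * x = c • (x * K)) : K' * x = c⁻¹ • (x * K') := by
  have : K' * (K * x) * K' = K' * (c • (x * K)) * K' := by rw [h]
  rw [← mul_assoc, h2, one_mul, mul_smul_comm, smul_mul_assoc, mul_assoc, mul_assoc, h1,
    mul_one] at this
  rw [this, smul_smul, inv_mul_cancel₀ hc, one_smul]

theorem kinv_e (h : PreSerreRelations D q e f k k') (hq : q ≠ 0) (i j : I) :
    k' i * e j = (q ^ D.d i) ^ (-D.C i j) • (e j * k' i) := by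
  rw [zpow_neg]
  exact comm_inv (zpow_ne_zero _ (pow_ne_zero _ hq)) (h.k_kinv i) (h.kinv_k i) (h.k_e i j)

theorem kinv_f (h : PreSerreRelations D q e f k k') (hq : q ≠ 0) (i j : I) :
    k' i * f j = (q ^ D.d i) ^ (D.C i j) • (f j * k' i) := by
  have := comm_inv (zpow_ne_zero _ (pow_ne_zero _ hq)) (h.k_kinv i) (h.kinv_k i) (h.k_f i j)
  rwa [zpow_neg, inv_inv] at this

/-- The Chevalley involution exchanges the roles of `e` and `f`, and of `k` and `k⁻¹`. -/
theorem symm (h : PreSerreRelations D q e f k k') (hq : q ≠ 0) :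
    PreSerreRelations D q f e k' k where
  k_kinv := h.kinv_k
  kinv_k := h.k_kinv
  k_k i j := by
    have a : Commute (k i) (k j) := h.k_k i j
    let u (i : I) : Aˣ := ⟨k i, k' i, h.k_kinv i, h.kinv_k i⟩
    have : Commute (↑(u i)⁻¹ : A) (↑(u j)⁻¹ : A) :=
      (Commute.units_inv_right (Commute.units_inv_left a : Commute (↑(u i)⁻¹ : A) (u j)))
    exact this
  k_e := h.kinv_f hq
  k_f := h.kinv_e hq
  e_f i := by
    rw [← neg_sub, h.e_f, ← smul_neg, neg_sub]
  e_f_ne i j hij := (h.e_f_ne j i hij.symm).symm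

/-- In the absence of the Serre relations, the Serre elements in the `f i` still commute with all
`e l`. -/
theorem commute_serreElement_f (h : PreSerreRelations D q e f k k') (hq : IsGenericParam q)
    {i j : I} (hij : i ≠ j) (l : I) :
    e l * serreElement (q ^ D.d i) (1 - D.C i j).toNat (f i) (f j) =
      serreElement (q ^ D.d i) (1 - D.C i j).toNat (f i) (f j) * e l := by
  have hQ := hq.pow (D.d_pos i)
  obtain ⟨N, hN⟩ : ∃ N : ℕ, D.C i j = -N :=
    ⟨(-D.C i j).toNat, by have := D.C_nonpos i j hij; omega⟩
  have hN1 : (1 - D.C i j).toNat = N + 1 := by omega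
  rw [hN1]
  by_cases hli : l = i
  · subst hli
    refine commute_serreElement_of_raising hQ N (K := k l) (K' := k' l) ?_ ?_ ?_ ?_ (h.e_f l)
      (h.e_f_ne l j hij)
    · simpa [D.C_diag] using h.k_f l l
    · simpa [D.C_diag] using h.kinv_f hq.1 l l
    · simpa [hN] using h.k_f l j
    · simpa [hN] using h.kinv_f hq.1 l j
  · rw [← sub_eq_zero, mul_serreElement_of_commute _ _ _ (h.e_f_ne l i hli)]
    by_cases hlj : l = j
    · subst hlj
      have e1 : (q ^ D.d l) ^ (-D.C l i) = (q ^ D.d i) ^ (N : ℤ) := by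
        rw [zpow_neg, D.qPow_symm, ← zpow_neg, hN, neg_neg]
      have e2 : (q ^ D.d l) ^ (D.C l i) = ((q ^ D.d i)⁻¹) ^ (N : ℤ) := by
        rw [D.qPow_symm, hN, zpow_neg, inv_zpow]
      rw [h.e_f, serreElement_smul, serreElement_sub,
        serreElement_eq_zero_of_comm hQ N (by rw [h.k_f, e1]), ← serreElement_inv,
        serreElement_eq_zero_of_comm hQ.inv N (by rw [h.kinv_f hq.1, e2]), sub_zero, smul_zero]
    · rw [h.e_f_ne l j hlj, sub_self]
      simp [serreElement]

theorem commute_serreElement_e (h : PreSerreRelations D q e f k k') (hq : IsGenericParam q)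
    {i j : I} (hij : i ≠ j) (l : I) :
    f l * serreElement (q ^ D.d i) (1 - D.C i j).toNat (e i) (e j) =
      serreElement (q ^ D.d i) (1 - D.C i j).toNat (e i) (e j) * f l :=
  (h.symm hq.1).commute_serreElement_f hq hij l

/-- Operators satisfying the relations of `U_q(𝔤)` define a representation. -/
noncomputable def toHom (h : PreSerreRelations D q e f k k')
    (he : ∀ i j, i ≠ j → serreElement (q ^ D.d i) (1 - D.C i j).toNat (e i) (e j) = 0)
    (hf : ∀ i j, i ≠ j → serreElement (q ^ D.d i) (1 - D.C i j).toNat (f i) (f j) = 0) :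
    Uq D q →ₐ[ℂ] A :=
  Uq.lift (FreeAlgebra.lift ℂ fun
    | .e i => e i
    | .f i => f i
    | .k i => k i
    | .kinv i => k' i) (by
    intro x y hxy
    cases hxy with
    | k_kinv i => simpa using h.k_kinv i
    | kinv_k i => simpa using h.kinv_k i
    | k_k i j => simpa using h.k_k i j
    | k_e i j => simpa using h.k_e i j
    | k_f i j => simpa using h.k_f i j
    | e_f i => simpa using h.e_f i
    | e_f_ne i j hij => simpa [sub_eq_zero] using h.e_f_ne i j hij
    | serre_e i j hij => simpa [Uq.map_serreElement] using he i j hij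
    | serre_f i j hij => simpa [Uq.map_serreElement] using hf i j hij)

end PreSerreRelations

namespace Uq

variable {I : Type*} {D : CartanDatum I} {q : ℂ}

/-- The generators of `U_q(𝔤)` satisfy the defining relations. -/
theorem preSerreRelations : PreSerreRelations D q (A := Uq D q) (fun i => gen D q (.e i))
    (fun i => gen D q (.f i)) (fun i => gen D q (.k i)) (fun i => gen D q (.kinv i)) where
  k_kinv i := by simpa [gen] using proj_rel (UqRel.k_kinv (D := D) (q := q) i)
  kinv_k i := by simpa [gen] using proj_rel (UqRel.kinv_k (D := D) (q := q) i)
  k_k i j := by simpa [gen] using proj_rel (UqRel.k_k (D := D) (q := q) i j)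
  k_e i j := by simpa [gen] using proj_rel (UqRel.k_e (D := D) (q := q) i j)
  k_f i j := by simpa [gen] using proj_rel (UqRel.k_f (D := D) (q := q) i j)
  e_f i := by simpa [gen] using proj_rel (UqRel.e_f (D := D) (q := q) i)
  e_f_ne i j hij := by
    simpa [gen, sub_eq_zero] using proj_rel (UqRel.e_f_ne (D := D) (q := q) i j hij)

theorem serre_e {i j : I} (hij : i ≠ j) :
    serreElement (q ^ D.d i) (1 - D.C i j).toNat (gen D q (.e i)) (gen D q (.e j)) = 0 := by
  simpa [gen, map_serreElement] using proj_rel (UqRel.serre_e (D := D) (q := q) i j hij)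

theorem serre_f {i j : I} (hij : i ≠ j) :
    serreElement (q ^ D.d i) (1 - D.C i j).toNat (gen D q (.f i)) (gen D q (.f j)) = 0 := by
  simpa [gen, map_serreElement] using proj_rel (UqRel.serre_f (D := D) (q := q) i j hij)

end Uq

/-! ### Strings of weight spaces for quantum `sl₂` -/

/-- A graded representation of quantum `sl₂`: operators `E`, `F` of degree `2` and `-2` with respect
to a family of subspaces `U m`, with `[E, F] = [m]_q` on `U m`. -/
structure IsQuantumSl2 {V : Type*} [AddCommGroup V] [Module ℂ V] (q : ℂ) (E F : Module.End ℂ V)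
    (U : ℤ → Submodule ℂ V) : Prop where
  raise : ∀ m, ∀ v ∈ U m, E v ∈ U (m + 2)
  lower : ∀ m, ∀ v ∈ U m, F v ∈ U (m - 2)
  comm : ∀ m, ∀ v ∈ U m, E (F v) - F (E v) = qIntZ q m • v

namespace IsQuantumSl2

variable {V : Type*} [AddCommGroup V] [Module ℂ V] {q : ℂ} {E F : Module.End ℂ V}
  {U : ℤ → Submodule ℂ V}

theorem symm (h : IsQuantumSl2 q E F U) : IsQuantumSl2 q F E fun m => U (-m) where
  raise m v hv := by
    have := h.lower _ v hv
    rwa [show -m - 2 = -(m + 2) by ring] at this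
  lower m v hv := by
    have := h.raise _ v hv
    rwa [show -m + 2 = -(m - 2) by ring] at this
  comm m v hv := by
    have := h.comm _ v hv
    rw [qIntZ_neg] at this
    rw [← neg_sub, this, neg_smul, neg_neg]

theorem pow_raise (h : IsQuantumSl2 q E F U) (r : ℕ) {m : ℤ} {v : V} (hv : v ∈ U m) :
    (E ^ r) v ∈ U (m + 2 * r) := by
  induction r with
  | zero => simpa using hv
  | succ r ih =>
    rw [pow_succ', Module.End.mul_apply]
    have := h.raise _ _ ih
    rwa [show m + 2 * r + 2 = m + 2 * ((r + 1 : ℕ) : ℤ) by push_cast; ring] at this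

theorem pow_lower (h : IsQuantumSl2 q E F U) (r : ℕ) {m : ℤ} {v : V} (hv : v ∈ U m) :
    (F ^ r) v ∈ U (m - 2 * r) := by
  have := h.symm.pow_raise r (m := -m) (v := v) (by simpa using hv)
  simpa [neg_add_eq_sub] using this

theorem qIntZ_identity (hq : IsGenericParam q) (m s : ℤ) :
    qIntZ q (m + 2 * (s + 1)) + qIntZ q (s + 1) * qIntZ q (m + s) =
      qIntZ q (s + 2) * qIntZ q (m + s + 1) := by
  have h := hq.sub_inv_ne_zero
  have h0 := hq.1
  have hm : q ^ m ≠ 0 := zpow_ne_zero _ h0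
  have hs : q ^ s ≠ 0 := zpow_ne_zero _ h0
  simp only [qIntZ, mul_add, neg_add, zpow_add₀ h0, zpow_neg, mul_one, two_mul]
  rw [div_mul_div_comm, div_mul_div_comm, div_add_div _ _ h (mul_ne_zero h h),
    div_eq_div_iff (mul_ne_zero h (mul_ne_zero h h)) (mul_ne_zero h h)]
  have e2 : q ^ (2 : ℤ) = q * q := by rw [zpow_ofNat, pow_two]
  rw [e2, zpow_one]
  generalize q ^ m = a at *
  generalize q ^ s = b at *
  clear hq e2 h
  field_simp
  ring

/-- The commutation rule of `E ^ (s + 1)` with `F` on vectors of weight `m`. -/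
theorem pow_raise_lower (h : IsQuantumSl2 q E F U) (hq : IsGenericParam q) (s : ℕ) {m : ℤ} {v : V}
    (hv : v ∈ U m) :
    (E ^ (s + 1)) (F v) =
      F ((E ^ (s + 1)) v) + (qIntZ q (s + 1) * qIntZ q (m + s)) • (E ^ s) v := by
  induction s with
  | zero =>
    have h1 : qIntZ q 1 = 1 := by simpa [qIntZ] using div_self hq.sub_inv_ne_zero
    simp [h1, ← h.comm m v hv]
  | succ s ih =>
    rw [pow_succ' E (s + 1), Module.End.mul_apply, ih, map_add, map_smul]
    have := h.comm _ _ (h.pow_raise (s + 1) hv)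
    rw [sub_eq_iff_eq_add] at this
    have hs : E ((E ^ s) v) = (E ^ (s + 1)) v := by rw [pow_succ', Module.End.mul_apply]
    rw [this, Module.End.mul_apply, hs, add_comm (_ • _), add_assoc, ← add_smul]
    congr 2
    push_cast
    rw [qIntZ_identity hq]
    (congr 2; all_goals ring)

/-- A power of `E` that does not lead beyond the weight opposite to that of `v` does not kill `v`,
provided that `F` acts nilpotently on `v`. -/
theorem eq_zero_of_pow_raise_eq_zero (h : IsQuantumSl2 q E F U) (hq : IsGenericParam q) {N : ℕ} :
    ∀ {r : ℕ} {m : ℤ} {v : V}, v ∈ U m → (F ^ N) v = 0 → (E ^ r) v = 0 → m + r ≤ 0 → v = 0 := by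
  induction N with
  | zero => intro r m v _ h1 _ _; simpa using h1
  | succ N ihN =>
    intro r
    induction r with
    | zero => intro m v _ _ h1 _; simpa using h1
    | succ s ihs =>
      intro m v hv hF hE hm
      have hm' : m + s < 0 := by push_cast at hm; omega
      have ha : qIntZ q (s + 1) * qIntZ q (m + s) ≠ 0 :=
        mul_ne_zero (qIntZ_ne_zero hq (by omega)) (qIntZ_ne_zero hq (by omega))
      set a := qIntZ q (s + 1) * qIntZ q (m + s) with ha_def
      have hEF := h.pow_raise_lower hq s hv
      rw [hE, map_zero, zero_add, ← ha_def] at hEF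
      have hFv : (F ^ N) (F v) = 0 := by rwa [← Module.End.mul_apply, ← pow_succ]
      -- The inner induction hypothesis shows that `v` is a multiple of `E (F v)`.
      have hv' : v - a⁻¹ • E (F v) = 0 := by
        refine ihs (m := m) ?_ ?_ ?_ (by omega)
        · refine sub_mem hv (Submodule.smul_mem _ _ ?_)
          have := h.raise _ _ (h.lower _ _ hv)
          rwa [sub_add_cancel] at this
        · have := h.symm.pow_raise_lower hq N (m := -(m - 2)) (v := F v)
            (by simpa using h.lower _ _ hv)
          have hFF : (F ^ (N + 1)) (F v) = 0 := by
            rw [← Module.End.mul_apply, ← pow_succ, pow_succ', Module.End.mul_apply, hF, map_zero]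
          rw [hFF, hFv, map_zero, smul_zero, add_zero] at this
          rw [map_sub, map_smul, hF, this, smul_zero, sub_zero]
        · rw [map_sub, map_smul, ← Module.End.mul_apply, ← pow_succ, hEF, smul_smul,
            inv_mul_cancel₀ ha, one_smul, sub_self]
      -- Hence `F v` is killed by `E ^ (s + 2)`, and the outer induction hypothesis applies to it.
      have hFv0 : F v = 0 := by
        refine ihN (r := s + 2) (h.lower _ _ hv) hFv ?_ (by push_cast; omega)
        rw [pow_succ' E (s + 1), Module.End.mul_apply, hEF, map_smul, ← Module.End.mul_apply,
          ← pow_succ', hE, smul_zero]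
      rw [hFv0, map_zero, smul_zero, sub_zero] at hv'
      exact hv'

end IsQuantumSl2

/-! ### Weight spaces of operators -/

section WeightSpaces

variable {I : Type*} {D : CartanDatum I} {q : ℂ} {V : Type*} [AddCommGroup V] [Module ℂ V]

/-- The common eigenspace of the operators `k i` with eigenvalues `q_i ^ γ_i`. -/
noncomputable def opWeightSpace (D : CartanDatum I) (q : ℂ) (k : I → Module.End ℂ V) (γ : D.Weight) :
    Submodule ℂ V :=
  ⨅ i, (k i).eigenspace ((q ^ D.d i) ^ γ i)

theorem mem_opWeightSpace {k : I → Module.End ℂ V} {γ : D.Weight} {x : V} :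
    x ∈ opWeightSpace D q k γ ↔ ∀ i, k i x = (q ^ D.d i) ^ γ i • x := by
  simp [opWeightSpace, Submodule.mem_iInf]

/-- The product of the operators `f j` over a word in the index set, applied to `v`. -/
noncomputable def wordAct (f : I → Module.End ℂ V) (w : List I) (v : V) : V := (w.map f).prod v

@[simp] theorem wordAct_nil (f : I → Module.End ℂ V) (v : V) : wordAct f [] v = v := rfl

@[simp] theorem wordAct_cons (f : I → Module.End ℂ V) (j : I) (w : List I) (v : V) :
    wordAct f (j :: w) v = f j (wordAct f w v) := by
  simp [wordAct]

theorem wordAct_append (f : I → Module.End ℂ V) (w w' : List I) (v : V) :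
    wordAct f (w ++ w') v = wordAct f w (wordAct f w' v) := by
  simp [wordAct]

/-- The weight `γ - ∑_{j ∈ w} α_j`. -/
def wordWeight (γ : D.Weight) (w : List I) : D.Weight := γ - (w.map D.simpleRoot).sum

@[simp] theorem wordWeight_nil (γ : D.Weight) : wordWeight γ [] = γ := by simp [wordWeight]

@[simp] theorem wordWeight_cons (γ : D.Weight) (j : I) (w : List I) :
    wordWeight γ (j :: w) = wordWeight γ w - D.simpleRoot j := by
  simp [wordWeight]; abel

theorem iSupIndep_opWeightSpace (hq : IsGenericParam q) {k : I → Module.End ℂ V}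
    (hk : ∀ i j, k i * k j = k j * k i) : iSupIndep (opWeightSpace D q k) := by
  have h1 : iSupIndep fun χ : I → ℂ => ⨅ i, (k i).maxGenEigenspace (χ i) :=
    Module.End.independent_iInf_maxGenEigenspace_of_forall_mapsTo k fun i j φ =>
      Module.End.mapsTo_maxGenEigenspace_of_comm (hk j i) φ
  have h2 : Function.Injective fun (γ : D.Weight) (i : I) => (q ^ D.d i) ^ γ i :=
    fun γ γ' h => funext fun i => hq.zpow_injective (D.d_pos i) (congrFun h i)
  refine (h1.comp h2).mono fun γ => iInf_mono fun i => ?_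
  exact (k i).genEigenspace _ |>.mono le_top

/-- Independent subspaces are determined by smaller ones that already span the whole space. -/
theorem _root_.iSupIndep.eq_of_le_of_iSup_eq_top {ι : Type*} {U W : ι → Submodule ℂ V}
    (hW : iSupIndep W) (hUW : ∀ i, U i ≤ W i) (hU : ⨆ i, U i = ⊤) (i : ι) : W i = U i := by
  refine le_antisymm (fun x hx => ?_) (hUW i)
  have hx' : x ∈ U i ⊔ ⨆ j ≠ i, U j := by
    have : (⨆ j, U j) ≤ U i ⊔ ⨆ j ≠ i, U j := iSup_le fun j => by
      by_cases hj : j = i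
      · subst hj; exact le_sup_left
      · exact le_sup_of_le_right (le_iSup₂_of_le j hj le_rfl)
    rw [hU] at this
    exact this trivial
  obtain ⟨y, hy, z, hz, rfl⟩ := Submodule.mem_sup.1 hx'
  have hzW : z ∈ W i := by simpa using sub_mem hx (hUW i hy)
  have : z ∈ (W i) ⊓ ⨆ j ≠ i, W j := ⟨hzW, iSup₂_mono (fun j _ => hUW j) hz⟩
  rw [(hW i).eq_bot, Submodule.mem_bot] at this
  rwa [this, add_zero]

namespace PreSerreRelations

variable {e f k k' : I → Module.End ℂ V}

theorem kinv_apply (h : PreSerreRelations D q e f k k') (hq : q ≠ 0) {i : I} {x : V} {m : ℤ}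
    (hx : k i x = (q ^ D.d i) ^ m • x) : k' i x = (q ^ D.d i) ^ (-m) • x := by
  have h1 : k' i (k i x) = x := by rw [← Module.End.mul_apply, h.kinv_k, Module.End.one_apply]
  rw [hx, map_smul] at h1
  have h0 : (q ^ D.d i) ^ m ≠ 0 := zpow_ne_zero _ (pow_ne_zero _ hq)
  rw [zpow_neg, ← h1, smul_smul, inv_mul_cancel₀ h0, one_smul, h1]

theorem e_mem_eigenspace (h : PreSerreRelations D q e f k k') (hq : q ≠ 0) {i : I} (j : I) {x : V}
    {m : ℤ} (hx : k i x = (q ^ D.d i) ^ m • x) :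
    k i (e j x) = (q ^ D.d i) ^ (m + D.C i j) • e j x := by
  have := DFunLike.congr_fun (h.k_e i j) x
  simp only [Module.End.mul_apply, LinearMap.smul_apply] at this
  rw [this, hx, map_smul, smul_smul, add_comm m, zpow_add₀ (pow_ne_zero _ hq)]

theorem f_mem_eigenspace (h : PreSerreRelations D q e f k k') (hq : q ≠ 0) {i : I} (j : I) {x : V}
    {m : ℤ} (hx : k i x = (q ^ D.d i) ^ m • x) :
    k i (f j x) = (q ^ D.d i) ^ (m - D.C i j) • f j x := by
  have := DFunLike.congr_fun (h.k_f i j) x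
  simp only [Module.End.mul_apply, LinearMap.smul_apply] at this
  rw [this, hx, map_smul, smul_smul, ← zpow_add₀ (pow_ne_zero _ hq), sub_eq_neg_add]

theorem e_mem (h : PreSerreRelations D q e f k k') (hq : q ≠ 0) {γ : D.Weight} (j : I) {x : V}
    (hx : x ∈ opWeightSpace D q k γ) : e j x ∈ opWeightSpace D q k (γ + D.simpleRoot j) :=
  mem_opWeightSpace.2 fun i => h.e_mem_eigenspace hq j (mem_opWeightSpace.1 hx i)

theorem f_mem (h : PreSerreRelations D q e f k k') (hq : q ≠ 0) {γ : D.Weight} (j : I) {x : V}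
    (hx : x ∈ opWeightSpace D q k γ) : f j x ∈ opWeightSpace D q k (γ - D.simpleRoot j) :=
  mem_opWeightSpace.2 fun i => h.f_mem_eigenspace hq j (mem_opWeightSpace.1 hx i)

theorem e_pow_mem (h : PreSerreRelations D q e f k k') (hq : q ≠ 0) {γ : D.Weight} (j : I) {x : V}
    (hx : x ∈ opWeightSpace D q k γ) (n : ℕ) :
    (e j ^ n) x ∈ opWeightSpace D q k (γ + n • D.simpleRoot j) := by
  induction n with
  | zero => simpa using hx
  | succ n ih =>
    rw [pow_succ', Module.End.mul_apply, succ_nsmul, ← add_assoc]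
    exact h.e_mem hq j ih

theorem wordAct_mem (h : PreSerreRelations D q e f k k') (hq : q ≠ 0) {γ : D.Weight} {v : V}
    (hv : v ∈ opWeightSpace D q k γ) (w : List I) :
    wordAct f w v ∈ opWeightSpace D q k (wordWeight γ w) := by
  induction w with
  | nil => simpa using hv
  | cons j w ih => simpa using h.f_mem hq j ih

theorem e_f_apply (h : PreSerreRelations D q e f k k') (hq : q ≠ 0) (i : I) {x : V} {m : ℤ}
    (hx : k i x = (q ^ D.d i) ^ m • x) :
    e i (f i x) = f i (e i x) + qIntZ (q ^ D.d i) m • x := by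
  have := DFunLike.congr_fun (h.e_f i) x
  simp only [Module.End.mul_apply, LinearMap.smul_apply, LinearMap.sub_apply, hx,
    h.kinv_apply hq hx, ← sub_smul, smul_smul] at this
  rw [← sub_eq_iff_eq_add', this, qIntZ, div_eq_inv_mul]

theorem isQuantumSl2 (h : PreSerreRelations D q e f k k') (hq : q ≠ 0) (i : I) :
    IsQuantumSl2 (q ^ D.d i) (e i) (f i)
      fun m => (k i).eigenspace ((q ^ D.d i) ^ m) where
  raise m v hv := by
    rw [Module.End.mem_eigenspace_iff] at hv ⊢
    simpa [D.C_diag] using h.e_mem_eigenspace hq i hv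
  lower m v hv := by
    rw [Module.End.mem_eigenspace_iff] at hv ⊢
    simpa [D.C_diag] using h.f_mem_eigenspace hq i hv
  comm m v hv := by
    rw [Module.End.mem_eigenspace_iff] at hv
    rw [sub_eq_iff_eq_add', h.e_f_apply hq i hv]

/-- A module spanned by the vectors obtained from a vector of weight `μ` by applying words in the
`f i` has no other weight vectors than the obvious ones. -/
theorem opWeightSpace_eq_span (h : PreSerreRelations D q e f k k') (hq : IsGenericParam q)
    {μ : D.Weight} {v : V} (hv : v ∈ opWeightSpace D q k μ)
    (hspan : ⊤ ≤ Submodule.span ℂ (Set.range fun w => wordAct f w v)) (γ : D.Weight) :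
    opWeightSpace D q k γ =
      Submodule.span ℂ ((fun w => wordAct f w v) '' {w | wordWeight μ w = γ}) := by
  refine (iSupIndep_opWeightSpace hq h.k_k).eq_of_le_of_iSup_eq_top
    (U := fun γ => Submodule.span ℂ ((fun w => wordAct f w v) '' {w | wordWeight μ w = γ}))
    (fun γ => ?_) ?_ γ
  · rw [Submodule.span_le]
    rintro _ ⟨w, rfl, rfl⟩
    exact h.wordAct_mem hq.1 hv w
  · refine top_le_iff.1 (hspan.trans (Submodule.span_le.2 ?_))
    rintro _ ⟨w, rfl⟩
    exact Submodule.mem_iSup_of_mem (wordWeight μ w) (Submodule.subset_span ⟨w, rfl, rfl⟩)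

theorem iSup_opWeightSpace_eq_top (h : PreSerreRelations D q e f k k') (hq : q ≠ 0)
    {μ : D.Weight} {v : V} (hv : v ∈ opWeightSpace D q k μ)
    (hspan : ⊤ ≤ Submodule.span ℂ (Set.range fun w => wordAct f w v)) :
    ⨆ γ, opWeightSpace D q k γ = ⊤ := by
  refine top_le_iff.1 (hspan.trans (Submodule.span_le.2 ?_))
  rintro _ ⟨w, rfl⟩
  exact Submodule.mem_iSup_of_mem (wordWeight μ w) (h.wordAct_mem hq hv w)

theorem e_wordAct_mem_span (h : PreSerreRelations D q e f k k') (hq : q ≠ 0)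
    {μ : D.Weight} {v : V} (hv : v ∈ opWeightSpace D q k μ) (hev : ∀ i, e i v = 0) (i : I)
    (w : List I) :
    e i (wordAct f w v) ∈ Submodule.span ℂ (Set.range fun w => wordAct f w v) := by
  have hf : ∀ (j : I), ∀ x ∈ Submodule.span ℂ (Set.range fun w => wordAct f w v),
      f j x ∈ Submodule.span ℂ (Set.range fun w => wordAct f w v) := by
    intro j x hx
    induction hx using Submodule.span_induction with
    | mem x hx =>
      obtain ⟨w, rfl⟩ := hx
      exact Submodule.subset_span ⟨j :: w, by simp⟩
    | zero => simp
    | add x y _ _ hx hy => rw [map_add]; exact add_mem hx hy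
    | smul c x _ hx => rw [map_smul]; exact Submodule.smul_mem _ _ hx
  induction w with
  | nil => simp [hev]
  | cons j w ih =>
    rw [wordAct_cons]
    by_cases hij : i = j
    · subst hij
      rw [h.e_f_apply hq i (mem_opWeightSpace.1 (h.wordAct_mem hq hv w) i)]
      exact add_mem (hf _ _ ih) (Submodule.smul_mem _ _ (Submodule.subset_span ⟨w, rfl⟩))
    · rw [← Module.End.mul_apply, h.e_f_ne i j hij, Module.End.mul_apply]
      exact hf _ _ ih

end PreSerreRelations

end WeightSpaces

/-! ### The geometry of the weight lattice -/

namespace CartanDatum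

variable {I : Type*} [Fintype I] (D : CartanDatum I)

open Matrix

theorem exists_root_coordinates : ∃ x : D.Weight →+ (I → ℝ),
    ∀ (γ : D.Weight) i, ∑ j, (D.C i j : ℝ) * x γ j = γ i := by
  classical
  set B : Matrix I I ℝ := Matrix.of fun i j => (D.d i : ℝ) * (D.C i j : ℝ) with hB
  have hu : IsUnit B.det := (isUnit_iff_isUnit_det B).1 D.posDef.isUnit
  refine ⟨⟨⟨fun γ => B⁻¹ *ᵥ fun i => (D.d i : ℝ) * (γ i : ℝ), ?_⟩, ?_⟩, fun γ i => ?_⟩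
  · simp only [Pi.zero_apply, Int.cast_zero, mul_zero]
    exact mulVec_zero _
  · intro γ γ'
    rw [← mulVec_add]
    refine congrArg (B⁻¹ *ᵥ ·) (funext fun i => ?_)
    simp [mul_add]
  · have h1 : B *ᵥ (B⁻¹ *ᵥ fun i => (D.d i : ℝ) * (γ i : ℝ)) = fun i => (D.d i : ℝ) * (γ i : ℝ) := by
      rw [mulVec_mulVec, mul_nonsing_inv _ hu, one_mulVec]
    have h2 := congrFun h1 i
    have hd : (D.d i : ℝ) ≠ 0 := by exact_mod_cast (D.d_pos i).ne'
    apply mul_left_cancel₀ hd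
    rw [← h2, mulVec, dotProduct, Finset.mul_sum]
    simp [hB, mul_assoc]

/-- The coordinates of a weight with respect to the simple roots. -/
noncomputable def rootCoord : D.Weight →+ (I → ℝ) := D.exists_root_coordinates.choose

theorem C_mul_rootCoord (γ : D.Weight) (i : I) : ∑ j, (D.C i j : ℝ) * D.rootCoord γ j = γ i :=
  D.exists_root_coordinates.choose_spec γ i

/-- The Weyl group invariant scalar product of a weight with an element of the root space. -/
noncomputable def pairing (x y : I → ℝ) : ℝ := ∑ i, ∑ j, x i * ((D.d i : ℝ) * D.C i j) * y j

theorem pairing_eq (x y : I → ℝ) :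
    D.pairing x y = x ⬝ᵥ (Matrix.of fun i j => (D.d i : ℝ) * (D.C i j : ℝ)) *ᵥ y := by
  simp [pairing, dotProduct, mulVec, Finset.mul_sum, mul_assoc]

theorem pairing_comm (x y : I → ℝ) : D.pairing x y = D.pairing y x := by
  rw [pairing, Finset.sum_comm, pairing]
  refine Finset.sum_congr rfl fun i _ => Finset.sum_congr rfl fun j _ => ?_
  have : (D.d i : ℝ) * D.C i j = D.d j * D.C j i := by exact_mod_cast D.d_mul_C_symm i j
  rw [this]; ring

theorem pairing_self_pos {x : I → ℝ} (hx : x ≠ 0) : 0 < D.pairing x x := by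
  rw [pairing_eq]
  simpa using D.posDef.dotProduct_mulVec_pos hx

theorem pairing_self_nonneg (x : I → ℝ) : 0 ≤ D.pairing x x := by
  rcases eq_or_ne x 0 with rfl | hx
  · simp [pairing]
  · exact (D.pairing_self_pos hx).le

theorem pairing_add_right (x y z : I → ℝ) :
    D.pairing x (y + z) = D.pairing x y + D.pairing x z := by
  simp [pairing, mul_add, Finset.sum_add_distrib]

theorem pairing_sub_right (x y z : I → ℝ) :
    D.pairing x (y - z) = D.pairing x y - D.pairing x z := by
  simp [pairing, mul_sub, Finset.sum_sub_distrib]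

theorem pairing_smul_right (c : ℝ) (x y : I → ℝ) :
    D.pairing x (c • y) = c * D.pairing x y := by
  simp only [pairing, Finset.mul_sum, Pi.smul_apply, smul_eq_mul]
  exact Finset.sum_congr rfl fun i _ => Finset.sum_congr rfl fun j _ => by ring

theorem pairing_rootCoord (x : I → ℝ) (γ : D.Weight) :
    D.pairing x (D.rootCoord γ) = ∑ i, x i * D.d i * γ i := by
  refine Finset.sum_congr rfl fun i _ => ?_
  rw [← D.C_mul_rootCoord γ i, Finset.mul_sum]
  exact Finset.sum_congr rfl fun j _ => by ring

open scoped Classical in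
theorem rootCoord_simpleRoot (i : I) : D.rootCoord (D.simpleRoot i) = Pi.single i 1 := by
  by_contra hne
  have h0 : D.rootCoord (D.simpleRoot i) - Pi.single i 1 ≠ 0 := sub_ne_zero.2 hne
  refine (D.pairing_self_pos h0).ne' ?_
  rw [pairing_sub_right, pairing_rootCoord, pairing, ← Finset.sum_sub_distrib]
  refine Finset.sum_eq_zero fun j _ => ?_
  simp [Pi.single_apply, simpleRoot, mul_assoc]

/-- The height of a weight: the sum of its coordinates with respect to the simple roots. -/
noncomputable def height : D.Weight →+ ℝ where
  toFun γ := ∑ i, D.rootCoord γ i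
  map_zero' := by simp
  map_add' γ γ' := by simp [Finset.sum_add_distrib]

theorem height_simpleRoot (i : I) : D.height (D.simpleRoot i) = 1 := by
  classical
  simp only [height, AddMonoidHom.coe_mk, ZeroHom.coe_mk, rootCoord_simpleRoot]
  rw [Finset.sum_eq_single i] <;> simp +contextual

/-- The Weyl group invariant square length of a weight. -/
noncomputable def sqLength (γ : D.Weight) : ℝ := D.pairing (D.rootCoord γ) (D.rootCoord γ)

theorem pairing_simpleRoot (i : I) (γ : D.Weight) :
    D.pairing (D.rootCoord (D.simpleRoot i)) (D.rootCoord γ) = D.d i * γ i := by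
  classical
  rw [pairing_rootCoord, rootCoord_simpleRoot]
  rw [Finset.sum_eq_single i] <;> simp +contextual

theorem sqLength_sub_smul (γ : D.Weight) (i : I) (t : ℝ) :
    D.pairing (D.rootCoord γ - t • D.rootCoord (D.simpleRoot i))
      (D.rootCoord γ - t • D.rootCoord (D.simpleRoot i)) =
      D.sqLength γ - 2 * t * (D.d i * γ i) + 2 * D.d i * t ^ 2 := by
  have h1 := D.pairing_simpleRoot i γ
  have h2 := D.pairing_simpleRoot i (D.simpleRoot i)
  have h3 : (D.simpleRoot i i : ℝ) = 2 := by simp [simpleRoot, D.C_diag]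
  rw [h3] at h2
  rw [sqLength, pairing_sub_right, pairing_smul_right, pairing_comm, pairing_sub_right,
    pairing_comm D (_ - _) (D.rootCoord (D.simpleRoot i)), pairing_sub_right, pairing_smul_right,
    pairing_smul_right, pairing_comm D (D.rootCoord γ) (D.rootCoord (D.simpleRoot i)), h1, h2]
  ring

theorem sqLength_simpleReflection (i : I) (γ : D.Weight) :
    D.sqLength (D.simpleReflection i γ) = D.sqLength γ := by
  have h : D.rootCoord (D.simpleReflection i γ) =
      D.rootCoord γ - (γ i : ℝ) • D.rootCoord (D.simpleRoot i) := by
    rw [simpleReflection_apply, map_sub, map_zsmul, Int.cast_smul_eq_zsmul]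
  rw [sqLength, h, sqLength_sub_smul]
  ring

/-- The Cauchy--Schwarz inequality with a simple root: the discriminant is replaced by the length of
`γ - (γ i / 2) α_i`. -/
theorem sq_le_sqLength (γ : D.Weight) (i : I) : (γ i : ℝ) ^ 2 ≤ 2 * D.sqLength γ := by
  have h := D.pairing_self_nonneg (D.rootCoord γ - (γ i / 2 : ℝ) • D.rootCoord (D.simpleRoot i))
  rw [sqLength_sub_smul] at h
  have hd : (1 : ℝ) ≤ D.d i := by exact_mod_cast D.d_pos i
  nlinarith [sq_nonneg (γ i : ℝ)]

theorem finite_sqLength_le (R : ℝ) : {γ : D.Weight | D.sqLength γ ≤ R}.Finite := by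
  obtain ⟨n, hn⟩ := exists_nat_gt (2 * R)
  refine (Set.Finite.pi' (t := fun _ : I => Set.Icc (-n : ℤ) n)
    fun _ => Set.finite_Icc _ _).subset fun γ hγ i => ?_
  have h1 := D.sq_le_sqLength γ i
  have h2 : (γ i : ℝ) ^ 2 ≤ n := by
    have : D.sqLength γ ≤ R := hγ
    linarith
  have h3 : (γ i) ^ 2 ≤ (n : ℤ) := by exact_mod_cast h2
  constructor <;> nlinarith

theorem height_wordWeight (μ : D.Weight) (w : List I) :
    D.height (wordWeight μ w) = D.height μ - w.length := by
  induction w with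
  | nil => simp
  | cons j w ih =>
    rw [wordWeight_cons, map_sub, ih, height_simpleRoot, List.length_cons]
    push_cast; ring

theorem wordWeight_eq_self {μ : D.Weight} {w : List I} : wordWeight μ w = μ ↔ w = [] := by
  constructor
  · intro h
    have := D.height_wordWeight μ w
    rw [h] at this
    rw [← List.length_eq_zero_iff]
    exact_mod_cast (by linarith : (w.length : ℝ) = 0)
  · rintro rfl; simp

/-- A dominant weight below a dominant weight `μ` is not longer than `μ`: the difference
`μ - ν` is a sum of simple roots, which pair non-negatively with `μ + ν`. -/
theorem sqLength_wordWeight_le {μ : D.Weight} {w : List I} (hμ : ∀ i, 0 ≤ μ i)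
    (hν : ∀ i, 0 ≤ wordWeight μ w i) : D.sqLength (wordWeight μ w) ≤ D.sqLength μ := by
  -- The induction is over a word not tied to the weight `ν` in the second argument.
  have key : ∀ w' : List I, 0 ≤ D.pairing (D.rootCoord (w'.map D.simpleRoot).sum)
      (D.rootCoord (μ + wordWeight μ w)) := by
    intro w'
    induction w' with
    | nil => simp [pairing]
    | cons j w' ih =>
      rw [List.map_cons, List.sum_cons, map_add, pairing_comm, pairing_add_right, pairing_comm,
        pairing_simpleRoot, pairing_comm]
      refine add_nonneg (mul_nonneg (Nat.cast_nonneg _) ?_) ih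
      exact_mod_cast add_nonneg (hμ j) (hν j)
  have h1 := key w
  have h2 : (w.map D.simpleRoot).sum = μ - wordWeight μ w := by simp [wordWeight]
  rw [h2, map_sub, map_add, pairing_add_right, pairing_comm, pairing_sub_right,
    pairing_comm D (_ - _) (D.rootCoord (wordWeight μ w)), pairing_sub_right] at h1
  rw [sqLength, sqLength]
  linarith [D.pairing_comm (D.rootCoord (wordWeight μ w)) (D.rootCoord μ)]

end CartanDatum

/-! ### Simple highest weight modules without Serre relations -/

section HighestWeight

variable {I : Type*} {V : Type*} [AddCommGroup V] [Module ℂ V]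

/-- Operators `e`, `f`, `k`, `k'` on `V` satisfying the relations of a quantum group up to the Serre
relations, such that `V` is generated by a highest weight vector `v` of weight `μ`, together with a
functional `φ`, which reads off the coefficient of `v`; the nondegeneracy condition says that no
non-zero submodule lies in the kernel of `φ`, that is, that `V` is simple. -/
structure IsSimpleHighestWeight (D : CartanDatum I) (q : ℂ) (μ : D.Weight)
    (e f k k' : I → Module.End ℂ V) (φ : V →ₗ[ℂ] ℂ) (v : V) : Prop where
  rel : PreSerreRelations D q e f k k'
  v_mem : v ∈ opWeightSpace D q k μ
  e_v : ∀ i, e i v = 0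
  φ_v : φ v = 1
  φ_f : ∀ i x, φ (f i x) = 0
  span : ⊤ ≤ Submodule.span ℂ (Set.range fun w => wordAct f w v)
  nondeg : ∀ x, (∀ l, φ (wordAct e l x) = 0) → x = 0

/-- The largest subspace of the kernel of `φ` that is stable under the operators `e i`. -/
noncomputable def radical (e : I → Module.End ℂ V) (φ : V →ₗ[ℂ] ℂ) : Submodule ℂ V :=
  ⨅ l : List I, LinearMap.ker (φ ∘ₗ (l.map e).prod)

theorem mem_radical {e : I → Module.End ℂ V} {φ : V →ₗ[ℂ] ℂ} {x : V} :
    x ∈ radical e φ ↔ ∀ l, φ (wordAct e l x) = 0 := by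
  simp [radical, Submodule.mem_iInf, wordAct]

theorem e_mem_radical {e : I → Module.End ℂ V} {φ : V →ₗ[ℂ] ℂ} {x : V} (hx : x ∈ radical e φ)
    (i : I) : e i x ∈ radical e φ := by
  rw [mem_radical] at hx ⊢
  intro l
  have := hx (l ++ [i])
  rwa [wordAct_append, wordAct_cons, wordAct_nil] at this

/-- The radical is stable under an operator that commutes with the `e i` up to scalars and
multiplies `φ` by a scalar. -/
theorem mem_radical_of_comm {e : I → Module.End ℂ V} {φ : V →ₗ[ℂ] ℂ} {k : Module.End ℂ V}
    (hk : ∀ j, ∃ c : ℂ, ∀ x, e j (k x) = c • k (e j x)) (hφ : ∃ c : ℂ, ∀ x, φ (k x) = c * φ x)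
    {x : V} (hx : x ∈ radical e φ) : k x ∈ radical e φ := by
  have key : ∀ l, ∃ c : ℂ, ∀ x, φ (wordAct e l (k x)) = c * φ (wordAct e l x) := by
    intro l
    induction l using List.reverseRecOn with
    | nil => simpa using hφ
    | append_singleton l i ih =>
      obtain ⟨c, hc⟩ := ih
      obtain ⟨c', hc'⟩ := hk i
      refine ⟨c' * c, fun x => ?_⟩
      have hs : wordAct e l (c' • k (e i x)) = c' • wordAct e l (k (e i x)) := by
        simp [wordAct]
      rw [wordAct_append, wordAct_append, wordAct_cons, wordAct_nil, wordAct_cons, wordAct_nil, hc',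
        hs, map_smul, hc, smul_eq_mul, mul_assoc]
  rw [mem_radical] at hx ⊢
  intro l
  obtain ⟨c, hc⟩ := key l
  rw [hc, hx, mul_zero]

variable {D : CartanDatum I} {q : ℂ} {e f k k' : I → Module.End ℂ V} {φ : V →ₗ[ℂ] ℂ}

theorem PreSerreRelations.k_mem_radical (h : PreSerreRelations D q e f k k') (hq : q ≠ 0) (i : I)
    (hφ : ∃ c : ℂ, ∀ x, φ (k i x) = c * φ x) {x : V} (hx : x ∈ radical e φ) :
    k i x ∈ radical e φ := by
  refine mem_radical_of_comm (fun j => ⟨((q ^ D.d i) ^ (D.C i j))⁻¹, fun x => ?_⟩) hφ hx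
  have := DFunLike.congr_fun (h.k_e i j) x
  simp only [Module.End.mul_apply, LinearMap.smul_apply] at this
  rw [this, smul_smul, inv_mul_cancel₀ (zpow_ne_zero _ (pow_ne_zero _ hq)), one_smul]

theorem PreSerreRelations.kinv_mem_radical (h : PreSerreRelations D q e f k k') (hq : q ≠ 0)
    (i : I) (hφ : ∃ c : ℂ, ∀ x, φ (k' i x) = c * φ x) {x : V} (hx : x ∈ radical e φ) :
    k' i x ∈ radical e φ := by
  refine mem_radical_of_comm (fun j => ⟨((q ^ D.d i) ^ (-D.C i j))⁻¹, fun x => ?_⟩) hφ hx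
  have := DFunLike.congr_fun (h.kinv_e hq i j) x
  simp only [Module.End.mul_apply, LinearMap.smul_apply] at this
  rw [this, smul_smul, inv_mul_cancel₀ (zpow_ne_zero _ (pow_ne_zero _ hq)), one_smul]

/-- The radical is stable under the `f j`: these can be moved past the `e i`, and `φ` vanishes on
their image. -/
theorem PreSerreRelations.f_mem_radical (h : PreSerreRelations D q e f k k') (hq : q ≠ 0) (j : I)
    (hφf : ∀ i x, φ (f i x) = 0) (hφk : ∀ i, ∃ c : ℂ, ∀ x, φ (k i x) = c * φ x)
    (hφk' : ∀ i, ∃ c : ℂ, ∀ x, φ (k' i x) = c * φ x) {x : V} (hx : x ∈ radical e φ) :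
    f j x ∈ radical e φ := by
  rw [mem_radical]
  intro l
  induction l using List.reverseRecOn generalizing x with
  | nil => simpa using hφf j x
  | append_singleton l i ih =>
    rw [wordAct_append, wordAct_cons, wordAct_nil]
    have hadd : ∀ y z, wordAct e l (y + z) = wordAct e l y + wordAct e l z := fun y z => by
      simp [wordAct]
    by_cases hij : i = j
    · subst hij
      have h1 := DFunLike.congr_fun (h.e_f i) x
      simp only [Module.End.mul_apply, LinearMap.smul_apply, LinearMap.sub_apply] at h1
      rw [sub_eq_iff_eq_add'] at h1
      rw [h1, hadd, map_add, ih (e_mem_radical hx i), zero_add]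
      refine mem_radical.1 (Submodule.smul_mem _ _ (sub_mem ?_ ?_)) l
      · exact h.k_mem_radical hq i (hφk i) hx
      · exact h.kinv_mem_radical hq i (hφk' i) hx
    · rw [← Module.End.mul_apply, h.e_f_ne i j hij, Module.End.mul_apply]
      exact ih (e_mem_radical hx i)

/-- Relations pass to the quotient by a stable subspace. -/
theorem PreSerreRelations.mapQ (h : PreSerreRelations D q e f k k') (N : Submodule ℂ V)
    (he : ∀ i, N ≤ N.comap (e i)) (hf : ∀ i, N ≤ N.comap (f i)) (hk : ∀ i, N ≤ N.comap (k i))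
    (hk' : ∀ i, N ≤ N.comap (k' i)) :
    PreSerreRelations D q (fun i => N.mapQ N (e i) (he i)) (fun i => N.mapQ N (f i) (hf i))
      (fun i => N.mapQ N (k i) (hk i)) (fun i => N.mapQ N (k' i) (hk' i)) := by
  have ext : ∀ {a b : Module.End ℂ (V ⧸ N)}, (∀ x : V, a (N.mkQ x) = b (N.mkQ x)) → a = b :=
    fun hab => LinearMap.ext fun y => by
      obtain ⟨x, rfl⟩ := N.mkQ_surjective y
      exact hab x
  constructor
  · intro i; exact ext fun x => congrArg N.mkQ (DFunLike.congr_fun (h.k_kinv i) x)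
  · intro i; exact ext fun x => congrArg N.mkQ (DFunLike.congr_fun (h.kinv_k i) x)
  · intro i j; exact ext fun x => congrArg N.mkQ (DFunLike.congr_fun (h.k_k i j) x)
  · intro i j; exact ext fun x => congrArg N.mkQ (DFunLike.congr_fun (h.k_e i j) x)
  · intro i j; exact ext fun x => congrArg N.mkQ (DFunLike.congr_fun (h.k_f i j) x)
  · intro i; exact ext fun x => congrArg N.mkQ (DFunLike.congr_fun (h.e_f i) x)
  · intro i j hij; exact ext fun x => congrArg N.mkQ (DFunLike.congr_fun (h.e_f_ne i j hij) x)

theorem wordAct_mapQ (N : Submodule ℂ V) (he : ∀ i, N ≤ N.comap (e i)) (w : List I) (x : V) :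
    wordAct (fun i => N.mapQ N (e i) (he i)) w (N.mkQ x) = N.mkQ (wordAct e w x) := by
  induction w with
  | nil => rfl
  | cons j w ih => simp only [wordAct_cons, ih]; rfl

/-- Dividing out the radical makes the functional nondegenerate. -/
theorem PreSerreRelations.exists_isSimpleHighestWeight (h : PreSerreRelations D q e f k k')
    (hq : q ≠ 0) {μ : D.Weight} {v : V} (hv : v ∈ opWeightSpace D q k μ) (hev : ∀ i, e i v = 0)
    (hφv : φ v = 1) (hφf : ∀ i x, φ (f i x) = 0)
    (hφk : ∀ i, ∃ c : ℂ, ∀ x, φ (k i x) = c * φ x)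
    (hφk' : ∀ i, ∃ c : ℂ, ∀ x, φ (k' i x) = c * φ x)
    (hspan : ⊤ ≤ Submodule.span ℂ (Set.range fun w => wordAct f w v)) :
    ∃ (N : Submodule ℂ V) (e f k k' : I → Module.End ℂ (V ⧸ N)) (ψ : (V ⧸ N) →ₗ[ℂ] ℂ) (u : V ⧸ N),
      IsSimpleHighestWeight D q μ e f k k' ψ u := by
  set N := radical e φ with hN
  have he : ∀ i, N ≤ N.comap (e i) := fun i x hx => e_mem_radical hx i
  have hf : ∀ i, N ≤ N.comap (f i) := fun i x hx => h.f_mem_radical hq i hφf hφk hφk' hx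
  have hk : ∀ i, N ≤ N.comap (k i) := fun i x hx => h.k_mem_radical hq i (hφk i) hx
  have hk' : ∀ i, N ≤ N.comap (k' i) := fun i x hx => h.kinv_mem_radical hq i (hφk' i) hx
  have hφN : N ≤ LinearMap.ker φ := fun x hx => mem_radical.1 hx []
  refine ⟨N, fun i => N.mapQ N (e i) (he i), fun i => N.mapQ N (f i) (hf i),
    fun i => N.mapQ N (k i) (hk i), fun i => N.mapQ N (k' i) (hk' i), N.liftQ φ hφN, N.mkQ v,
    h.mapQ N he hf hk hk', ?_, ?_, ?_, ?_, ?_, ?_⟩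
  · exact mem_opWeightSpace.2 fun i => congrArg N.mkQ (mem_opWeightSpace.1 hv i)
  · intro i
    have := congrArg N.mkQ (hev i)
    simpa using this
  · simpa using hφv
  · intro i y
    obtain ⟨x, rfl⟩ := N.mkQ_surjective y
    simpa using hφf i x
  · have := Submodule.map_mono (f := N.mkQ) hspan
    rw [Submodule.map_top, Submodule.range_mkQ, Submodule.map_span, ← Set.range_comp] at this
    have h2 : (fun w => wordAct (fun i => N.mapQ N (f i) (hf i)) w (N.mkQ v)) =
        N.mkQ ∘ fun w => wordAct f w v := funext fun w => wordAct_mapQ N hf w v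
    rw [h2]
    exact this
  · intro y hy
    obtain ⟨x, rfl⟩ := N.mkQ_surjective y
    rw [Submodule.mkQ_apply, Submodule.Quotient.mk_eq_zero, hN, mem_radical]
    intro l
    have := hy l
    rw [wordAct_mapQ] at this
    simpa using this

end HighestWeight

/-! ### The free highest weight module -/

section Verma

variable {I : Type*} (D : CartanDatum I) (q : ℂ) (μ : D.Weight)

/-- The operator `f_j` on the space with basis the words in `I`: it adds a letter. -/
noncomputable def freeF (j : I) : Module.End ℂ (List I →₀ ℂ) :=
  Finsupp.linearCombination ℂ fun w => Finsupp.single (j :: w) 1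

/-- The operator `k_i` (for `ε = 1`) or its inverse (for `ε = -1`) on the free highest weight
module, in which the word `w` has weight `μ - ∑_{j ∈ w} α_j`. -/
noncomputable def freeK (ε : ℤ) (i : I) : Module.End ℂ (List I →₀ ℂ) :=
  Finsupp.linearCombination ℂ fun w =>
    Finsupp.single w ((q ^ D.d i) ^ (ε * wordWeight μ w i))

open scoped Classical in
/-- The value of the operator `e_i` on a word; it is determined by the commutation relations with
the `f_j`. -/
noncomputable def freeEWord (i : I) : List I → (List I →₀ ℂ)
  | [] => 0
  | j :: w => freeF j (freeEWord i w) +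
      if i = j then Finsupp.single w (qIntZ (q ^ D.d i) (wordWeight μ w i)) else 0

/-- The operator `e_i` on the free highest weight module. -/
noncomputable def freeE (i : I) : Module.End ℂ (List I →₀ ℂ) :=
  Finsupp.linearCombination ℂ (freeEWord D q μ i)

variable {D q μ}

@[simp] theorem freeF_single (j : I) (w : List I) (c : ℂ) :
    freeF j (Finsupp.single w c) = Finsupp.single (j :: w) c := by
  simp [freeF]

@[simp] theorem freeK_single (ε : ℤ) (i : I) (w : List I) (c : ℂ) :
    freeK D q μ ε i (Finsupp.single w c) =
      (q ^ D.d i) ^ (ε * wordWeight μ w i) • Finsupp.single w c := by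
  simp [freeK, mul_comm]

@[simp] theorem freeE_single (i : I) (w : List I) :
    freeE D q μ i (Finsupp.single w 1) = freeEWord D q μ i w := by
  simp [freeE]

theorem end_ext {a b : Module.End ℂ (List I →₀ ℂ)}
    (h : ∀ w, a (Finsupp.single w 1) = b (Finsupp.single w 1)) : a = b :=
  Finsupp.lhom_ext' fun w => LinearMap.ext_ring (by simpa using h w)

theorem freeK_mul_freeF (hq : q ≠ 0) (ε : ℤ) (i j : I) :
    freeK D q μ ε i * freeF j = (q ^ D.d i) ^ (-(ε * D.C i j)) • (freeF j * freeK D q μ ε i) := by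
  refine end_ext fun w => ?_
  simp only [Module.End.mul_apply, LinearMap.smul_apply, freeF_single, freeK_single, map_smul,
    smul_smul, ← zpow_add₀ (pow_ne_zero (D.d i) hq), wordWeight_cons, Pi.sub_apply,
    CartanDatum.simpleRoot]
  congr 2
  ring

theorem freeK_freeEWord (hq : q ≠ 0) (ε : ℤ) (i j : I) (w : List I) :
    freeK D q μ ε i (freeEWord D q μ j w) =
      (q ^ D.d i) ^ (ε * (wordWeight μ w i + D.C i j)) • freeEWord D q μ j w := by
  have h0 := pow_ne_zero (D.d i) hq
  induction w with
  | nil => simp [freeEWord]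
  | cons l w ih =>
    have h1 := DFunLike.congr_fun (freeK_mul_freeF (D := D) (μ := μ) hq ε i l)
      (freeEWord D q μ j w)
    simp only [Module.End.mul_apply, LinearMap.smul_apply, ih, map_smul, smul_smul,
      ← zpow_add₀ h0] at h1
    simp only [freeEWord, map_add, smul_add, h1]
    congr 1
    · congr 2
      simp only [wordWeight_cons, Pi.sub_apply, CartanDatum.simpleRoot]
      ring
    · split_ifs with hjl
      · subst hjl
        rw [freeK_single]
        congr 2
        simp only [wordWeight_cons, Pi.sub_apply, CartanDatum.simpleRoot]
        ring
      · simp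

theorem freePreSerreRelations (hq : q ≠ 0) :
    PreSerreRelations D q (freeE D q μ) freeF (freeK D q μ 1) (freeK D q μ (-1)) where
  k_kinv i := end_ext fun w => by
    have h0 := pow_ne_zero (D.d i) hq
    simp only [Module.End.mul_apply, freeK_single, map_smul, smul_smul, ← zpow_add₀ h0]
    simp
  kinv_k i := end_ext fun w => by
    have h0 := pow_ne_zero (D.d i) hq
    simp only [Module.End.mul_apply, freeK_single, map_smul, smul_smul, ← zpow_add₀ h0]
    simp
  k_k i j := end_ext fun w => by
    simp only [Module.End.mul_apply, freeK_single, map_smul, smul_smul, mul_comm]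
  k_e i j := end_ext fun w => by
    have h0 := pow_ne_zero (D.d i) hq
    simp only [Module.End.mul_apply, LinearMap.smul_apply, freeK_single, map_smul, smul_smul,
      freeE_single, freeK_freeEWord hq, ← zpow_add₀ h0]
    congr 2
    ring
  k_f i j := by simpa using freeK_mul_freeF (D := D) (μ := μ) hq 1 i j
  e_f i := end_ext fun w => by
    simp only [Module.End.mul_apply, LinearMap.sub_apply, LinearMap.smul_apply, freeF_single,
      freeE_single, freeEWord, if_true, add_sub_cancel_left, freeK_single, ← sub_smul, smul_smul]
    rw [← mul_one (qIntZ _ _), ← smul_eq_mul, ← Finsupp.smul_single, qIntZ, div_eq_inv_mul,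
      one_mul, neg_one_mul]
  e_f_ne i j hij := end_ext fun w => by
    simp [freeEWord, hij]

theorem wordAct_freeF (w : List I) :
    wordAct freeF w (Finsupp.single [] 1) = Finsupp.single w 1 := by
  induction w with
  | nil => rfl
  | cons j w ih => simp [ih]

theorem lapply_nil_freeK (ε : ℤ) (i : I) : ∃ c : ℂ, ∀ x : List I →₀ ℂ,
    Finsupp.lapply (R := ℂ) [] (freeK D q μ ε i x) = c * Finsupp.lapply (R := ℂ) [] x := by
  refine ⟨(q ^ D.d i) ^ (ε * μ i), fun x => ?_⟩
  have : (Finsupp.lapply (R := ℂ) ([] : List I)) ∘ₗ freeK D q μ ε i =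
      (q ^ D.d i) ^ (ε * μ i) • Finsupp.lapply (R := ℂ) ([] : List I) := by
    refine Finsupp.lhom_ext' fun w => LinearMap.ext_ring ?_
    rcases w with _ | ⟨j, w⟩ <;> simp
  exact DFunLike.congr_fun this x

theorem lapply_nil_freeF (j : I) (x : List I →₀ ℂ) :
    Finsupp.lapply (R := ℂ) [] (freeF j x) = 0 := by
  have : (Finsupp.lapply (R := ℂ) ([] : List I)) ∘ₗ freeF j = 0 := by
    refine Finsupp.lhom_ext' fun w => LinearMap.ext_ring ?_
    simp
  exact DFunLike.congr_fun this x

theorem exists_isSimpleHighestWeight (hq : q ≠ 0) (μ : D.Weight) :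
    ∃ (N : Submodule ℂ (List I →₀ ℂ)) (e f k k' : I → Module.End ℂ ((List I →₀ ℂ) ⧸ N))
      (φ : ((List I →₀ ℂ) ⧸ N) →ₗ[ℂ] ℂ) (v : (List I →₀ ℂ) ⧸ N),
      IsSimpleHighestWeight D q μ e f k k' φ v := by
  refine (freePreSerreRelations (D := D) (μ := μ) hq).exists_isSimpleHighestWeight hq
    (μ := μ) (v := Finsupp.single [] 1) (φ := Finsupp.lapply []) ?_ ?_ ?_ lapply_nil_freeF
    (lapply_nil_freeK 1) (lapply_nil_freeK (-1)) ?_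
  · exact mem_opWeightSpace.2 fun i => by simp
  · intro i; simp [freeEWord]
  · simp
  · simp only [wordAct_freeF]
    intro x _
    induction x using Finsupp.induction_linear with
    | zero => exact zero_mem _
    | add x y hx hy => exact add_mem (hx trivial) (hy trivial)
    | single w c =>
      rw [← mul_one c, ← smul_eq_mul, ← Finsupp.smul_single]
      exact Submodule.smul_mem _ _ (Submodule.subset_span ⟨w, rfl⟩)

end Verma

/-! ### Serre relations and finite dimensionality of simple highest weight modules -/

section Simple

variable {I : Type*} {V : Type*} [AddCommGroup V] [Module ℂ V]
  {D : CartanDatum I} {q : ℂ} {μ : D.Weight} {e f k k' : I → Module.End ℂ V} {φ : V →ₗ[ℂ] ℂ} {v : V}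

theorem serreElement_apply (Q : ℂ) (n : ℕ) (x y : Module.End ℂ V) (u : V) :
    serreElement Q n x y u =
      ∑ r ∈ Finset.range (n + 1), ((-1) ^ r * qBinom Q n r) • (x ^ (n - r)) (y ((x ^ r) u)) := by
  simp [serreElement, LinearMap.sum_apply]

/-- The quantum Serre relation bounds the nilpotency order of `x` on `y u`. -/
theorem pow_apply_eq_zero_of_serre {Q : ℂ} (hQ : IsGenericParam Q) {n : ℕ} {x y : Module.End ℂ V}
    (h : serreElement Q n x y = 0) :
    ∀ {N : ℕ} {u : V}, (x ^ N) u = 0 → (x ^ (N + n)) (y u) = 0 := by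
  intro N
  induction N using Nat.strong_induction_on with
  | _ N ih =>
    intro u hu
    have h1 := DFunLike.congr_fun h u
    rw [serreElement_apply, Finset.sum_range_succ'] at h1
    simp only [pow_zero, qBinom_zero_right hQ, mul_one, one_smul, Nat.sub_zero,
      Module.End.one_apply, LinearMap.zero_apply] at h1
    have h2 := congrArg (x ^ N) h1
    rw [map_add, map_sum, map_zero, ← Module.End.mul_apply (x ^ N), ← pow_add] at h2
    rw [← h2, right_eq_add]
    refine Finset.sum_eq_zero fun r hr => ?_
    rw [Finset.mem_range] at hr
    rw [map_smul, ← Module.End.mul_apply (x ^ N), ← pow_add]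
    by_cases hrN : r + 1 ≤ N
    · have h3 : (x ^ (N - (r + 1))) ((x ^ (r + 1)) u) = 0 := by
        rw [← Module.End.mul_apply, ← pow_add, Nat.sub_add_cancel hrN, hu]
      have h4 := ih (N - (r + 1)) (by omega) h3
      rw [show N + (n - (r + 1)) = N - (r + 1) + n by omega, h4, smul_zero]
    · have h3 : (x ^ (r + 1)) u = 0 := by
        rw [show r + 1 = (r + 1 - N) + N by omega, pow_add, Module.End.mul_apply, hu, map_zero]
      rw [h3, map_zero, map_zero, smul_zero]

namespace IsSimpleHighestWeight

/-- The Serre elements commute with the `e l`, and `φ` vanishes on their image since they begin with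
some `f`. -/
theorem serre_f (h : IsSimpleHighestWeight D q μ e f k k' φ v) (hq : IsGenericParam q) {i j : I}
    (hij : i ≠ j) : serreElement (q ^ D.d i) (1 - D.C i j).toNat (f i) (f j) = 0 := by
  set n := (1 - D.C i j).toNat with hn
  refine LinearMap.ext fun x => h.nondeg _ fun l => ?_
  have hcomm : ∀ l y, wordAct e l (serreElement (q ^ D.d i) n (f i) (f j) y) =
      serreElement (q ^ D.d i) n (f i) (f j) (wordAct e l y) := by
    intro l y
    induction l with
    | nil => rfl
    | cons a l ih =>
      rw [wordAct_cons, ih, wordAct_cons, ← Module.End.mul_apply,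
        h.rel.commute_serreElement_f hq hij, Module.End.mul_apply]
  rw [hcomm, serreElement_apply, map_sum]
  refine Finset.sum_eq_zero fun r hr => ?_
  rw [map_smul]
  rcases Nat.eq_zero_or_pos (n - r) with h0 | h0
  · rw [h0, pow_zero, Module.End.one_apply, h.φ_f, smul_zero]
  · rw [← Nat.succ_pred_eq_of_pos h0, pow_succ', Module.End.mul_apply, h.φ_f, smul_zero]

/-- The Serre elements commute with the `f l` and kill the highest weight vector. -/
theorem serre_e (h : IsSimpleHighestWeight D q μ e f k k' φ v) (hq : IsGenericParam q) {i j : I}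
    (hij : i ≠ j) : serreElement (q ^ D.d i) (1 - D.C i j).toNat (e i) (e j) = 0 := by
  set n := (1 - D.C i j).toNat with hn
  set S := serreElement (q ^ D.d i) n (e i) (e j) with hS
  have hSv : S v = 0 := by
    rw [hS, serreElement_apply]
    refine Finset.sum_eq_zero fun r hr => ?_
    rcases r with _ | r
    · simp [h.e_v]
    · simp [pow_succ, h.e_v]
  have key : ∀ w, S (wordAct f w v) = 0 := by
    intro w
    induction w with
    | nil => exact hSv
    | cons a l ih =>
      rw [wordAct_cons, ← Module.End.mul_apply, hS, ← h.rel.commute_serreElement_e hq hij,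
        Module.End.mul_apply, ← hS, ih, map_zero]
  have : Submodule.span ℂ (Set.range fun w => wordAct f w v) ≤ LinearMap.ker S := by
    rw [Submodule.span_le]
    rintro _ ⟨w, rfl⟩
    exact key w
  exact LinearMap.ext fun x => this (h.span trivial)

/-- A singular vector without component along `v` vanishes. -/
theorem eq_zero_of_singular (h : IsSimpleHighestWeight D q μ e f k k' φ v) {x : V}
    (hx : ∀ i, e i x = 0) (hφ : φ x = 0) : x = 0 := by
  refine h.nondeg x fun l => ?_
  induction l using List.reverseRecOn with
  | nil => exact hφ
  | append_singleton l i _ =>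
    rw [wordAct_append, wordAct_cons, wordAct_nil, hx]
    simp [wordAct]

/-- The vector `f_i ^ (μ_i + 1) v` is singular. -/
theorem f_pow_v (h : IsSimpleHighestWeight D q μ e f k k' φ v) (hq : IsGenericParam q) {i : I}
    {m : ℕ} (hm : μ i = m) : (f i ^ (m + 1)) v = 0 := by
  refine h.eq_zero_of_singular (fun j => ?_) ?_
  · by_cases hij : j = i
    · subst hij
      have hv : v ∈ (k j).eigenspace ((q ^ D.d j) ^ (-(-(m : ℤ)))) := by
        rw [Module.End.mem_eigenspace_iff, neg_neg, ← hm]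
        exact mem_opWeightSpace.1 h.v_mem j
      have := (h.rel.isQuantumSl2 hq.1 j).symm.pow_raise_lower (hq.pow (D.d_pos j)) m
        (m := -(m : ℤ)) hv
      rw [h.e_v, map_zero, neg_add_cancel, qIntZ_zero, mul_zero, zero_smul, add_zero] at this
      exact this.symm
    · have hc : Commute (e j) (f i) := h.rel.e_f_ne j i hij
      have := DFunLike.congr_fun (hc.pow_right (m + 1)).eq v
      rw [Module.End.mul_apply, Module.End.mul_apply, h.e_v, map_zero] at this
      exact this
  · rw [pow_succ', Module.End.mul_apply, h.φ_f]

theorem exists_f_pow_eq_zero (h : IsSimpleHighestWeight D q μ e f k k' φ v)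
    (hq : IsGenericParam q) {i : I} (hμ : 0 ≤ μ i) (x : V) : ∃ N, (f i ^ N) x = 0 := by
  have key : ∀ w, ∃ N, (f i ^ N) (wordAct f w v) = 0 := by
    intro w
    induction w with
    | nil => exact ⟨_, h.f_pow_v hq (Int.toNat_of_nonneg hμ).symm⟩
    | cons j w ih =>
      obtain ⟨N, hN⟩ := ih
      rw [wordAct_cons]
      by_cases hij : i = j
      · subst hij
        refine ⟨N, ?_⟩
        rw [← Module.End.mul_apply, ← pow_succ, pow_succ', Module.End.mul_apply, hN, map_zero]
      · exact ⟨_, pow_apply_eq_zero_of_serre (hq.pow (D.d_pos i)) (h.serre_f hq hij) hN⟩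
  have hx : x ∈ Submodule.span ℂ (Set.range fun w => wordAct f w v) := h.span trivial
  induction hx using Submodule.span_induction with
  | mem x hx => obtain ⟨w, rfl⟩ := hx; exact key w
  | zero => exact ⟨0, by simp⟩
  | add x y _ _ hx hy =>
    obtain ⟨N, hN⟩ := hx
    obtain ⟨M, hM⟩ := hy
    refine ⟨N + M, ?_⟩
    have h1 : (f i ^ (N + M)) x = 0 := by
      rw [add_comm, pow_add, Module.End.mul_apply, hN, map_zero]
    have h2 : (f i ^ (N + M)) y = 0 := by rw [pow_add, Module.End.mul_apply, hM, map_zero]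
    rw [map_add, h1, h2, add_zero]
  | smul c x _ hx =>
    obtain ⟨N, hN⟩ := hx
    exact ⟨N, by rw [map_smul, hN, smul_zero]⟩

theorem v_ne_zero (h : IsSimpleHighestWeight D q μ e f k k' φ v) : v ≠ 0 := by
  rintro rfl
  simpa using h.φ_v

theorem exists_word (h : IsSimpleHighestWeight D q μ e f k k' φ v) (hq : IsGenericParam q)
    {γ : D.Weight} (hγ : opWeightSpace D q k γ ≠ ⊥) : ∃ w, wordWeight μ w = γ := by
  by_contra! hne
  apply hγ
  rw [h.rel.opWeightSpace_eq_span hq h.v_mem h.span]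
  have : {w | wordWeight μ w = γ} = ∅ := Set.eq_empty_of_forall_notMem fun w hw => hne w hw
  rw [this]
  simp

theorem opWeightSpace_simpleReflection_ne_bot (h : IsSimpleHighestWeight D q μ e f k k' φ v)
    (hq : IsGenericParam q) {i : I} (hμ : 0 ≤ μ i) {γ : D.Weight} (hγi : γ i ≤ 0)
    (hγ : opWeightSpace D q k γ ≠ ⊥) :
    opWeightSpace D q k (D.simpleReflection i γ) ≠ ⊥ := by
  obtain ⟨x, hx, hx0⟩ := Submodule.exists_mem_ne_zero_of_ne_bot hγ
  obtain ⟨n, hn⟩ : ∃ n : ℕ, γ i = -n := ⟨(-γ i).toNat, by omega⟩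
  obtain ⟨N, hN⟩ := h.exists_f_pow_eq_zero hq hμ x
  have hmem := h.rel.e_pow_mem hq.1 i hx n
  have hs : D.simpleReflection i γ = γ + n • D.simpleRoot i := by
    rw [D.simpleReflection_apply, hn, neg_smul, sub_neg_eq_add, natCast_zsmul]
  rw [← hs] at hmem
  refine Submodule.ne_bot_iff _ |>.2 ⟨_, hmem, fun h0 => hx0 ?_⟩
  refine (h.rel.isQuantumSl2 hq.1 i).eq_zero_of_pow_raise_eq_zero (hq.pow (D.d_pos i)) (m := -n)
    ?_ hN h0 (by omega)
  rw [Module.End.mem_eigenspace_iff, ← hn]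
  exact mem_opWeightSpace.1 hx i

/-- A weight that is not dominant can be reflected to a higher one of the same length, so the bound
follows from the case of a dominant weight. -/
theorem sqLength_le [Fintype I] (h : IsSimpleHighestWeight D q μ e f k k' φ v)
    (hq : IsGenericParam q) (hμ : ∀ i, 0 ≤ μ i) {γ : D.Weight}
    (hγ : opWeightSpace D q k γ ≠ ⊥) : D.sqLength γ ≤ D.sqLength μ := by
  obtain ⟨w, rfl⟩ := h.exists_word hq hγ
  induction hn : w.length using Nat.strong_induction_on generalizing w with
  | _ n ih =>
    by_cases hdom : ∀ i, 0 ≤ wordWeight μ w i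
    · exact D.sqLength_wordWeight_le hμ hdom
    · push Not at hdom
      obtain ⟨i, hi⟩ := hdom
      have h1 := h.opWeightSpace_simpleReflection_ne_bot hq (hμ i) hi.le hγ
      obtain ⟨w', hw'⟩ := h.exists_word hq h1
      rw [← D.sqLength_simpleReflection i, ← hw']
      rw [← hw'] at h1
      refine ih w'.length ?_ w' h1 rfl
      have h2 := congrArg D.height hw'
      rw [D.simpleReflection_apply, map_sub, map_zsmul, D.height_simpleRoot,
        D.height_wordWeight, D.height_wordWeight, hn, zsmul_eq_mul, mul_one] at h2
      have h3 : ((wordWeight μ w i : ℤ) : ℝ) < 0 := by exact_mod_cast hi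
      have h4 : (w'.length : ℝ) < n := by linarith
      exact_mod_cast h4

theorem finiteDimensional [Fintype I] (h : IsSimpleHighestWeight D q μ e f k k' φ v)
    (hq : IsGenericParam q) (hμ : ∀ i, 0 ≤ μ i) : FiniteDimensional ℂ V := by
  -- Only finitely many weights are short enough, so only words of bounded length act non-trivially.
  obtain ⟨b, hb⟩ := ((D.finite_sqLength_le (D.sqLength μ)).image D.height).bddBelow
  obtain ⟨n, hn⟩ := exists_nat_gt (D.height μ - b)
  have hword : ∀ w, wordAct f w v ≠ 0 → w.length ≤ n := by
    intro w hw
    have h1 : opWeightSpace D q k (wordWeight μ w) ≠ ⊥ :=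
      Submodule.ne_bot_iff _ |>.2 ⟨_, h.rel.wordAct_mem hq.1 h.v_mem w, hw⟩
    have h2 := hb (Set.mem_image_of_mem D.height
      (show wordWeight μ w ∈ {γ | D.sqLength γ ≤ D.sqLength μ} from h.sqLength_le hq hμ h1))
    rw [D.height_wordWeight] at h2
    have h3 : (w.length : ℝ) ≤ n := by linarith
    exact_mod_cast h3
  have hfin : ((fun w => wordAct f w v) '' {w | w.length ≤ n}).Finite :=
    (List.finite_length_le I n).image _
  have htop : Submodule.span ℂ ((fun w => wordAct f w v) '' {w | w.length ≤ n}) = ⊤ := by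
    refine top_le_iff.1 (h.span.trans (Submodule.span_le.2 ?_))
    rintro _ ⟨w, rfl⟩
    by_cases hw : wordAct f w v = 0
    · simp only [hw]; exact zero_mem _
    · exact Submodule.subset_span ⟨w, hword w hw, rfl⟩
  exact Module.finite_def.2 (htop ▸ Submodule.fg_span hfin)

theorem finrank_opWeightSpace_self [Fintype I] (h : IsSimpleHighestWeight D q μ e f k k' φ v)
    (hq : IsGenericParam q) : Module.finrank ℂ (opWeightSpace D q k μ) = 1 := by
  rw [h.rel.opWeightSpace_eq_span hq h.v_mem h.span]
  have : {w : List I | wordWeight μ w = μ} = {[]} := by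
    ext w; exact D.wordWeight_eq_self
  rw [this, Set.image_singleton, wordAct_nil]
  exact finrank_span_singleton h.v_ne_zero

end IsSimpleHighestWeight

/-- Operators on a finite-dimensional space satisfying the relations of `U_q(𝔤)`, for which the
space is the sum of its weight spaces, yield an object of `FDRep` with the same weight
multiplicities. -/
theorem exists_FDRep_of_operators [FiniteDimensional ℂ V] (h : PreSerreRelations D q e f k k')
    (he : ∀ i j, i ≠ j → serreElement (q ^ D.d i) (1 - D.C i j).toNat (e i) (e j) = 0)
    (hf : ∀ i j, i ≠ j → serreElement (q ^ D.d i) (1 - D.C i j).toNat (f i) (f j) = 0)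
    (htop : ⨆ γ, opWeightSpace D q k γ = ⊤) :
    ∃ M : FDRep D q, ∀ γ,
      Module.finrank ℂ (weightSpace D q M.carrier γ) =
        Module.finrank ℂ (opWeightSpace D q k γ) := by
  let n := Module.finrank ℂ V
  let E : V ≃ₗ[ℂ] (Fin n → ℂ) := (Module.finBasis ℂ V).equivFun
  let ρ : Uq D q →ₐ[ℂ] Module.End ℂ (Fin n → ℂ) :=
    (E.conjAlgEquiv ℂ).toAlgHom.comp (h.toHom he hf)
  let _ : Module (Uq D q) (Fin n → ℂ) := Module.compHom _ ρ.toRingHom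
  have hsmul : ∀ (u : Uq D q) (x : Fin n → ℂ), u • x = ρ u x := fun _ _ => rfl
  have : IsScalarTower ℂ (Uq D q) (Fin n → ℂ) := ⟨fun c u x => by
    rw [hsmul, hsmul, map_smul, LinearMap.smul_apply]⟩
  have hk : ∀ i x, Uq.k D q i • (E x) = E (k i x) := by
    intro i x
    rw [hsmul]
    simp [ρ, PreSerreRelations.toHom, Uq.lift_gen, LinearEquiv.conjAlgEquiv_apply]
  have hmap : ∀ γ, weightSpace D q (Fin n → ℂ) γ =
      (opWeightSpace D q k γ).map (E : V →ₗ[ℂ] (Fin n → ℂ)) := by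
    intro γ
    ext y
    obtain ⟨x, rfl⟩ := E.surjective y
    rw [mem_weightSpace]
    constructor
    · intro hx
      refine ⟨x, mem_opWeightSpace.2 fun i => E.injective ?_, rfl⟩
      rw [← hk, hx, map_smul]
    · rintro ⟨x', hx', hxx'⟩ i
      obtain rfl := E.injective hxx'
      rw [hk, mem_opWeightSpace.1 hx' i, map_smul]
  refine ⟨{ carrier := Fin n → ℂ, iSup_weightSpace := ?_ }, fun γ => ?_⟩
  · simp only [hmap]
    rw [← Submodule.map_iSup, htop, Submodule.map_top, LinearEquiv.range]
  · change Module.finrank ℂ (weightSpace D q (Fin n → ℂ) γ) = _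
    rw [hmap]
    exact LinearEquiv.finrank_map_eq E _

/-- For every dominant weight `μ` there is a finite-dimensional representation of highest weight
`μ`. -/
theorem exists_FDRep_highestWeight [Fintype I] (hq : IsGenericParam q) (hμ : ∀ i, 0 ≤ μ i) :
    ∃ M : FDRep D q, Module.finrank ℂ (weightSpace D q M.carrier μ) = 1 ∧
      ∀ γ, Module.finrank ℂ (weightSpace D q M.carrier γ) ≠ 0 →
        D.sqLength γ ≤ D.sqLength μ ∧ (γ = μ ∨ D.height γ < D.height μ) := by
  obtain ⟨N, e, f, k, k', φ, v, h⟩ := exists_isSimpleHighestWeight (D := D) hq.1 μ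
  have := h.finiteDimensional hq hμ
  obtain ⟨M, hM⟩ := exists_FDRep_of_operators h.rel (fun i j hij => h.serre_e hq hij)
    (fun i j hij => h.serre_f hq hij) (h.rel.iSup_opWeightSpace_eq_top hq.1 h.v_mem h.span)
  refine ⟨M, (hM μ).trans (h.finrank_opWeightSpace_self hq), fun γ hγ => ?_⟩
  rw [hM] at hγ
  have hγ' : opWeightSpace D q k γ ≠ ⊥ := by
    intro h0
    rw [h0] at hγ
    simp at hγ
  refine ⟨h.sqLength_le hq hμ hγ', ?_⟩
  obtain ⟨w, rfl⟩ := h.exists_word hq hγ'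
  rcases w with _ | ⟨j, w⟩
  · left; simp
  · right
    rw [D.height_wordWeight, List.length_cons]
    push_cast
    linarith [(Nat.cast_nonneg w.length : (0 : ℝ) ≤ w.length)]

end Simple

/-! ### Reflection operators on finite-dimensional modules -/

section Reflection

variable {I : Type*} {D : CartanDatum I} {q : ℂ} {V : Type*} [AddCommGroup V] [Module ℂ V]
  {e f k k' : I → Module.End ℂ V}

theorem PreSerreRelations.map {A B : Type*} [Ring A] [Algebra ℂ A] [Ring B] [Algebra ℂ B]
    {e f k k' : I → A} (h : PreSerreRelations D q e f k k') (φ : A →ₐ[ℂ] B) :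
    PreSerreRelations D q (fun i => φ (e i)) (fun i => φ (f i)) (fun i => φ (k i))
      (fun i => φ (k' i)) where
  k_kinv i := by rw [← map_mul, h.k_kinv, map_one]
  kinv_k i := by rw [← map_mul, h.kinv_k, map_one]
  k_k i j := by rw [← map_mul, h.k_k, map_mul]
  k_e i j := by rw [← map_mul, h.k_e, map_smul, map_mul]
  k_f i j := by rw [← map_mul, h.k_f, map_smul, map_mul]
  e_f i := by rw [← map_mul, ← map_mul, ← map_sub, h.e_f, map_smul, map_sub]
  e_f_ne i j hij := by rw [← map_mul, h.e_f_ne i j hij, map_mul]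

theorem PreSerreRelations.opWeightSpace_kinv (h : PreSerreRelations D q e f k k') (hq : q ≠ 0)
    (γ : D.Weight) : opWeightSpace D q k' γ = opWeightSpace D q k (-γ) := by
  ext x
  simp only [mem_opWeightSpace, Pi.neg_apply]
  constructor
  · intro hx i
    exact (h.symm hq).kinv_apply hq (hx i)
  · intro hx i
    simpa using h.kinv_apply hq (hx i)

/-- The powers of `f i` applied to `x` have distinct eigenvalues under `k i`. -/
theorem PreSerreRelations.exists_f_pow_eq_zero [FiniteDimensional ℂ V]
    (h : PreSerreRelations D q e f k k') (hq : IsGenericParam q) {i : I} {m : ℤ} {x : V}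
    (hx : x ∈ (k i).eigenspace ((q ^ D.d i) ^ m)) : ∃ N, (f i ^ N) x = 0 := by
  by_contra! hne
  have hinj : Function.Injective fun N : ℕ => (q ^ D.d i) ^ (m - 2 * N) := fun a b hab => by
    have : m - 2 * a = m - 2 * b := hq.zpow_injective (D.d_pos i) hab
    omega
  refine (Set.infinite_range_of_injective hinj).mono ?_ (k i).finite_hasEigenvalue
  rintro _ ⟨N, rfl⟩
  exact Module.End.hasEigenvalue_of_hasEigenvector
    ⟨(h.isQuantumSl2 hq.1 i).pow_lower N hx, hne N⟩

/-- The product of the operators `(e i) ^ n` over pairwise orthogonal nodes `i` is injective on a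
weight space whose weight has value `-n` on all these nodes. -/
theorem PreSerreRelations.wordAct_e_pow [FiniteDimensional ℂ V]
    (h : PreSerreRelations D q e f k k') (hq : IsGenericParam q) (n : ℕ) {l : List I}
    (hl : l.Pairwise fun i j => D.C i j = 0) {γ : D.Weight} (hγ : ∀ i ∈ l, γ i = -n) {x : V}
    (hx : x ∈ opWeightSpace D q k γ) :
    wordAct (fun i => e i ^ n) l x ∈ opWeightSpace D q k (γ + n • (l.map D.simpleRoot).sum) ∧
      (wordAct (fun i => e i ^ n) l x = 0 → x = 0) := by
  induction l with
  | nil => simpa using hx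
  | cons i l ih =>
    rw [List.pairwise_cons] at hl
    obtain ⟨h1, h2⟩ := ih hl.2 fun j hj => hγ j (List.mem_cons_of_mem _ hj)
    set y := wordAct (fun i => e i ^ n) l x with hy
    rw [wordAct_cons, ← hy, List.map_cons, List.sum_cons, smul_add, add_comm (n • _), ← add_assoc]
    refine ⟨h.e_pow_mem hq.1 i h1 n, fun h0 => h2 ?_⟩
    have hsum : (l.map D.simpleRoot).sum i = 0 := by
      change Pi.evalAddMonoidHom (fun _ : I => ℤ) i (l.map D.simpleRoot).sum = 0
      rw [map_list_sum, List.map_map]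
      refine List.sum_eq_zero fun z hz => ?_
      obtain ⟨j, hj, rfl⟩ := List.mem_map.1 hz
      exact hl.1 j hj
    have hyi : y ∈ (k i).eigenspace ((q ^ D.d i) ^ (-n : ℤ)) := by
      rw [Module.End.mem_eigenspace_iff, mem_opWeightSpace.1 h1 i, Pi.add_apply, Pi.smul_apply,
        hsum, smul_zero, add_zero, hγ i List.mem_cons_self]
    obtain ⟨N, hN⟩ := h.exists_f_pow_eq_zero hq hyi
    exact (h.isQuantumSl2 hq.1 i).eq_zero_of_pow_raise_eq_zero (hq.pow (D.d_pos i)) hyi hN h0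
      (by omega)

/-- The operator that maps a weight space, on whose weight all nodes in the list `l` have the value
`m`, to the reflected weight space: a product of powers of the `e i` or of the `f i`. -/
noncomputable def reflectionOp (e f : I → Module.End ℂ V) (m : ℤ) (l : List I) :
    Module.End ℂ V :=
  if m ≤ 0 then (l.map fun i => e i ^ (-m).toNat).prod else (l.map fun i => f i ^ m.toNat).prod

theorem PreSerreRelations.reflectionOp_mem [FiniteDimensional ℂ V]
    (h : PreSerreRelations D q e f k k') (hq : IsGenericParam q) {m : ℤ} {l : List I}
    (hl : l.Pairwise fun i j => D.C i j = 0) {γ : D.Weight} (hγ : ∀ i ∈ l, γ i = m) {x : V}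
    (hx : x ∈ opWeightSpace D q k γ) :
    reflectionOp e f m l x ∈ opWeightSpace D q k (γ - m • (l.map D.simpleRoot).sum) ∧
      (reflectionOp e f m l x = 0 → x = 0) := by
  rw [reflectionOp]
  split_ifs with hm
  · obtain ⟨n, rfl⟩ : ∃ n : ℕ, m = -n := ⟨(-m).toNat, by omega⟩
    have := h.wordAct_e_pow hq n hl hγ hx
    simpa [wordAct] using this
  · obtain ⟨n, rfl⟩ : ∃ n : ℕ, m = n := ⟨m.toNat, by omega⟩
    have hx' : x ∈ opWeightSpace D q k' (-γ) := by
      rwa [h.opWeightSpace_kinv hq.1, neg_neg]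
    have := (h.symm hq.1).wordAct_e_pow hq n hl (γ := -γ) (fun i hi => by simp [hγ i hi]) hx'
    rw [h.opWeightSpace_kinv hq.1, neg_add, neg_neg] at this
    simpa [wordAct, sub_eq_add_neg] using this

theorem PreSerreRelations.finrank_le_finrank_simpleReflection [FiniteDimensional ℂ V]
    (h : PreSerreRelations D q e f k k') (hq : IsGenericParam q) (i : I) (γ : D.Weight) :
    Module.finrank ℂ (opWeightSpace D q k γ) ≤
      Module.finrank ℂ (opWeightSpace D q k (D.simpleReflection i γ)) := by
  have hT : ∀ x ∈ opWeightSpace D q k γ,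
      reflectionOp e f (γ i) [i] x ∈ opWeightSpace D q k (D.simpleReflection i γ) ∧
        (reflectionOp e f (γ i) [i] x = 0 → x = 0) := fun x hx => by
    have := h.reflectionOp_mem hq (m := γ i) (l := [i]) (by simp) (by simp) hx
    rwa [List.map_singleton, List.sum_singleton, ← D.simpleReflection_apply] at this
  refine LinearMap.finrank_le_finrank_of_injective
    (f := (reflectionOp e f (γ i) [i]).restrict fun x hx => (hT x hx).1) ?_
  rw [← LinearMap.ker_eq_bot, LinearMap.ker_eq_bot']
  intro x hx
  exact Subtype.ext ((hT x x.2).2 (congrArg Subtype.val hx))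

end Reflection

/-! ### Modules over the quantum group -/

section Modules

variable {I : Type*} (D : CartanDatum I) (q : ℂ) (V : Type*) [AddCommGroup V] [Module ℂ V]
  [Module (Uq D q) V] [IsScalarTower ℂ (Uq D q) V]

/-- The action of an element of `U_q(𝔤)` on a module, as a linear operator. -/
noncomputable abbrev Uq.op (g : Uq D q) : Module.End ℂ V := Algebra.lsmul ℂ ℂ V g

theorem Uq.op_preSerreRelations : PreSerreRelations D q
    (fun i => Uq.op D q V (Uq.gen D q (.e i))) (fun i => Uq.op D q V (Uq.gen D q (.f i)))
    (fun i => Uq.op D q V (Uq.gen D q (.k i))) (fun i => Uq.op D q V (Uq.gen D q (.kinv i))) :=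
  Uq.preSerreRelations.map (Algebra.lsmul ℂ ℂ V : Uq D q →ₐ[ℂ] Module.End ℂ V)

theorem weightSpace_eq_opWeightSpace (γ : D.Weight) :
    weightSpace D q V γ = opWeightSpace D q (fun i => Uq.op D q V (Uq.gen D q (.k i))) γ := by
  ext x
  rw [mem_opWeightSpace, mem_weightSpace]
  rfl

variable {q}

theorem coeff_character [Finite I] [FiniteDimensional ℂ V] (hq : IsGenericParam q)
    (γ : D.Weight) :
    (character D V hq).coeff γ = Module.finrank ℂ (weightSpace D q V γ) := rfl

theorem finrank_weightSpace_simpleReflection [FiniteDimensional ℂ V] (hq : IsGenericParam q)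
    (i : I) (γ : D.Weight) :
    Module.finrank ℂ (weightSpace D q V (D.simpleReflection i γ)) =
      Module.finrank ℂ (weightSpace D q V γ) := by
  have h := fun γ => (Uq.op_preSerreRelations D q V).finrank_le_finrank_simpleReflection hq i γ
  rw [weightSpace_eq_opWeightSpace, weightSpace_eq_opWeightSpace]
  refine le_antisymm ?_ (h γ)
  have := h (D.simpleReflection i γ)
  rwa [D.simpleReflection_simpleReflection] at this

end Modules

/-! ### Weyl group invariants are virtual characters -/

section Virtual

variable {I : Type*} {D : CartanDatum I} {q : ℂ}

/-- The zero representation. -/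
noncomputable def FDRep.zero (D : CartanDatum I) (q : ℂ) : FDRep D q where
  carrier := PUnit
  iSup_weightSpace := Subsingleton.elim _ _

theorem weightSpace_prod {V W : Type*} [AddCommGroup V] [Module ℂ V] [Module (Uq D q) V]
    [IsScalarTower ℂ (Uq D q) V] [AddCommGroup W] [Module ℂ W] [Module (Uq D q) W]
    [IsScalarTower ℂ (Uq D q) W] (γ : D.Weight) :
    weightSpace D q (V × W) γ = (weightSpace D q V γ).prod (weightSpace D q W γ) := by
  ext ⟨x, y⟩
  simp only [mem_weightSpace, Submodule.mem_prod, Prod.smul_mk, Prod.mk.injEq, forall_and]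

/-- The direct sum of two representations. -/
noncomputable def FDRep.prod (M N : FDRep D q) : FDRep D q where
  carrier := M.carrier × N.carrier
  iSup_weightSpace := by
    rw [eq_top_iff]
    rintro ⟨x, y⟩ -
    have hx : x ∈ ⨆ γ, weightSpace D q M.carrier γ := by rw [M.iSup_weightSpace]; trivial
    have hy : y ∈ ⨆ γ, weightSpace D q N.carrier γ := by rw [N.iSup_weightSpace]; trivial
    have h1 : LinearMap.inl ℂ M.carrier N.carrier x ∈
        ⨆ γ, weightSpace D q (M.carrier × N.carrier) γ := by
      have := Submodule.mem_map_of_mem (f := LinearMap.inl ℂ M.carrier N.carrier) hx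
      rw [Submodule.map_iSup] at this
      refine SetLike.le_def.1 (iSup_mono fun γ => ?_) this
      rintro _ ⟨z, hz, rfl⟩
      rw [weightSpace_prod]
      exact ⟨hz, zero_mem _⟩
    have h2 : LinearMap.inr ℂ M.carrier N.carrier y ∈
        ⨆ γ, weightSpace D q (M.carrier × N.carrier) γ := by
      have := Submodule.mem_map_of_mem (f := LinearMap.inr ℂ M.carrier N.carrier) hy
      rw [Submodule.map_iSup] at this
      refine SetLike.le_def.1 (iSup_mono fun γ => ?_) this
      rintro _ ⟨z, hz, rfl⟩
      rw [weightSpace_prod]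
      exact ⟨zero_mem _, hz⟩
    simpa using add_mem h1 h2

theorem character_zero [Finite I] (hq : IsGenericParam q) :
    character D (FDRep.zero D q).carrier hq = 0 := by
  ext γ
  rw [coeff_character, AddMonoidAlgebra.coeff_zero, Finsupp.zero_apply, Nat.cast_eq_zero]
  have : Subsingleton (FDRep.zero D q).carrier := inferInstanceAs (Subsingleton PUnit)
  exact Module.finrank_zero_of_subsingleton

theorem character_prod [Finite I] (hq : IsGenericParam q) (M N : FDRep D q) :
    character D (M.prod N).carrier hq = character D M.carrier hq + character D N.carrier hq := by
  ext γ
  rw [AddMonoidAlgebra.coeff_add, Finsupp.add_apply, coeff_character, coeff_character,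
    coeff_character, ← Nat.cast_add, ← Module.finrank_prod]
  congr 1
  change Module.finrank ℂ (weightSpace D q (M.carrier × N.carrier) γ) = _
  rw [weightSpace_prod]
  exact LinearEquiv.finrank_eq
    { toFun := fun x => (⟨x.1.1, x.2.1⟩, ⟨x.1.2, x.2.2⟩)
      invFun := fun x => ⟨(x.1.1, x.2.1), x.1.2, x.2.2⟩
      map_add' := fun _ _ => rfl
      map_smul' := fun _ _ => rfl }

/-- The group of differences of characters of finite-dimensional representations. -/
noncomputable def virtualCharacters (D : CartanDatum I) [Finite I] (hq : IsGenericParam q) :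
    AddSubgroup (AddMonoidAlgebra ℤ D.Weight) where
  carrier := {χ | ∃ M N : FDRep D q, χ = character D M.carrier hq - character D N.carrier hq}
  zero_mem' := ⟨FDRep.zero D q, FDRep.zero D q, by simp⟩
  add_mem' := by
    rintro _ _ ⟨M, N, rfl⟩ ⟨M', N', rfl⟩
    refine ⟨M.prod M', N.prod N', ?_⟩
    rw [character_prod, character_prod]
    abel
  neg_mem' := by
    rintro _ ⟨M, N, rfl⟩
    exact ⟨N, M, by rw [neg_sub]⟩

theorem character_mem_virtualCharacters [Finite I] (hq : IsGenericParam q) (M : FDRep D q) :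
    character D M.carrier hq ∈ virtualCharacters D hq :=
  ⟨M, FDRep.zero D q, by rw [character_zero, sub_zero]⟩

/-- Subtracting multiples of characters of highest weight representations reduces an invariant to
one with smaller support. -/
theorem mem_virtualCharacters_of_invariant [Fintype I] (hq : IsGenericParam q)
    {χ : AddMonoidAlgebra ℤ D.Weight}
    (hχ : ∀ i γ, χ.coeff (D.simpleReflection i γ) = χ.coeff γ) : χ ∈ virtualCharacters D hq := by
  classical
  obtain ⟨R, hR⟩ := (χ.coeff.support.finite_toSet.image D.sqLength).bddAbove
  set T := (D.finite_sqLength_le R).toFinset with hT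
  have hmemT : ∀ γ, γ ∈ T ↔ D.sqLength γ ≤ R := fun γ => by simp [hT]
  -- The support is contained in a finite set `A` of short weights which is closed downwards with
  -- respect to the height; a highest element of `A` is removed in each step.
  suffices key : ∀ (n : ℕ) (A : Finset D.Weight), A.card = n → A ⊆ T →
      (∀ a ∈ A, ∀ b ∈ T, D.height b < D.height a → b ∈ A) →
      ∀ χ : AddMonoidAlgebra ℤ D.Weight,
        (∀ i γ, χ.coeff (D.simpleReflection i γ) = χ.coeff γ) →
        (∀ γ, χ.coeff γ ≠ 0 → γ ∈ A) → χ ∈ virtualCharacters D hq by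
    refine key _ T rfl subset_rfl (fun _ _ b hb _ => hb) χ hχ fun γ hγ => (hmemT γ).2 ?_
    exact hR (Set.mem_image_of_mem _ (Finsupp.mem_support_iff.2 hγ))
  intro n
  induction n with
  | zero =>
    intro A hA _ _ χ _ hsupp
    rw [Finset.card_eq_zero] at hA
    subst hA
    have : χ = 0 := by
      ext γ
      by_contra h0
      simpa using hsupp γ h0
    rw [this]
    exact zero_mem _
  | succ n ih =>
    intro A hA hAT hlow χ hχ hsupp
    obtain ⟨μ, hμA, hmax⟩ := A.exists_max_image D.height (Finset.card_pos.1 (by omega))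
    have hcard : (A.erase μ).card = n := by rw [Finset.card_erase_of_mem hμA, hA]; rfl
    have hlow' : ∀ a ∈ A.erase μ, ∀ b ∈ T, D.height b < D.height a → b ∈ A.erase μ := by
      intro a ha b hb hab
      rw [Finset.mem_erase] at ha ⊢
      refine ⟨?_, hlow a ha.2 b hb hab⟩
      rintro rfl
      exact absurd hab (not_lt.2 (hmax a ha.2))
    have hsub : A.erase μ ⊆ T := (Finset.erase_subset _ _).trans hAT
    by_cases hμ0 : χ.coeff μ = 0
    · refine ih _ hcard hsub hlow' χ hχ fun γ hγ => Finset.mem_erase.2 ⟨?_, hsupp γ hγ⟩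
      rintro rfl
      exact hγ hμ0
    · have hdom : ∀ i, 0 ≤ μ i := by
        intro i
        have h1 := hmax _ (hsupp (D.simpleReflection i μ) (by rwa [hχ]))
        rw [D.simpleReflection_apply, map_sub, map_zsmul, D.height_simpleRoot, zsmul_eq_mul,
          mul_one] at h1
        have : (0 : ℝ) ≤ (μ i : ℤ) := by linarith
        exact_mod_cast this
      obtain ⟨M, hM1, hM2⟩ := exists_FDRep_highestWeight hq hdom
      set χM := character D M.carrier hq with hχM
      have hcoeff : ∀ γ, (χ - χ.coeff μ • χM).coeff γ =
          χ.coeff γ - χ.coeff μ * Module.finrank ℂ (weightSpace D q M.carrier γ) := fun γ => by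
        rw [AddMonoidAlgebra.coeff_sub, Finsupp.sub_apply, AddMonoidAlgebra.coeff_smul,
          Finsupp.smul_apply, hχM, coeff_character, smul_eq_mul]
      have hmem : χ - χ.coeff μ • χM ∈ virtualCharacters D hq := by
        refine ih _ hcard hsub hlow' _ (fun i γ => ?_) fun γ hγ => ?_
        · rw [hcoeff, hcoeff, hχ, finrank_weightSpace_simpleReflection D M.carrier hq]
        · rw [hcoeff] at hγ
          have hne : γ ≠ μ := by
            rintro rfl
            exact hγ (by rw [hM1]; simp)
          refine Finset.mem_erase.2 ⟨hne, ?_⟩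
          by_cases h0 : χ.coeff γ = 0
          · have h1 : Module.finrank ℂ (weightSpace D q M.carrier γ) ≠ 0 := by
              intro h1
              exact hγ (by rw [h0, h1]; simp)
            obtain ⟨h2, h3⟩ := hM2 γ h1
            exact hlow μ hμA γ ((hmemT γ).2 (h2.trans ((hmemT μ).1 (hAT hμA))))
              (h3.resolve_left hne)
          · exact hsupp γ h0
      rw [← sub_add_cancel χ (χ.coeff μ • χM)]
      exact add_mem hmem (zsmul_mem (character_mem_virtualCharacters hq M) _)

end Virtual

/-! ### The operator attached to a diagram automorphism -/

section Cyclic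

variable {I : Type*} {D : CartanDatum I} {q : ℂ} {V : Type*} [AddCommGroup V] [Module ℂ V]

theorem Uq.mem_of_gen_mem (ρ : Uq D q →ₐ[ℂ] Module.End ℂ V) {S : Submodule ℂ V}
    (hS : ∀ x, ∀ u ∈ S, ρ (gen D q x) u ∈ S) (g : Uq D q) : ∀ u ∈ S, ρ g u ∈ S := by
  obtain ⟨a, rfl⟩ : ∃ a, proj D q a = g := RingQuot.mkAlgHom_surjective ℂ (UqRel D q) g
  induction a using FreeAlgebra.induction with
  | grade0 c =>
    intro u hu
    rw [AlgHom.commutes, AlgHom.commutes, Module.algebraMap_end_apply]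
    exact S.smul_mem c hu
  | grade1 x => exact hS x
  | mul a b ha hb =>
    intro u hu
    rw [map_mul, map_mul, Module.End.mul_apply]
    exact ha _ (hb u hu)
  | add a b ha hb =>
    intro u hu
    rw [map_add, map_add, LinearMap.add_apply]
    exact add_mem (ha u hu) (hb u hu)

/-- A cyclic module generated by a highest weight vector is spanned by the vectors obtained from it
by applying words in the `f i`. -/
theorem Uq.apply_mem_span_wordAct (ρ : Uq D q →ₐ[ℂ] Module.End ℂ V) (hq : q ≠ 0) {lam : D.Weight}
    {v : V} (hv : v ∈ opWeightSpace D q (fun i => ρ (gen D q (.k i))) lam)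
    (hev : ∀ i, ρ (gen D q (.e i)) v = 0) (g : Uq D q) :
    ρ g v ∈ Submodule.span ℂ (Set.range fun w => wordAct (fun i => ρ (gen D q (.f i))) w v) := by
  have h := Uq.preSerreRelations.map ρ
  refine Uq.mem_of_gen_mem ρ (fun x u hu => ?_) g v (Submodule.subset_span ⟨[], rfl⟩)
  induction hu using Submodule.span_induction with
  | mem u hu =>
    obtain ⟨w, rfl⟩ := hu
    have hw := h.wordAct_mem hq hv w
    cases x with
    | e i => exact h.e_wordAct_mem_span hq hv hev i w
    | f i => exact Submodule.subset_span ⟨i :: w, by simp⟩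
    | k i =>
      have := mem_opWeightSpace.1 hw i
      rw [this]
      exact Submodule.smul_mem _ _ (Submodule.subset_span ⟨w, rfl⟩)
    | kinv i =>
      have := h.kinv_apply hq (mem_opWeightSpace.1 hw i)
      rw [this]
      exact Submodule.smul_mem _ _ (Submodule.subset_span ⟨w, rfl⟩)
  | zero => rw [map_zero]; exact zero_mem _
  | add a b _ _ ha hb => rw [map_add]; exact add_mem ha hb
  | smul c a _ ha => rw [map_smul]; exact Submodule.smul_mem _ _ ha

variable {e f k k' : I → Module.End ℂ V}

/-- The functional reading off the coefficient of the highest weight vector. -/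
theorem PreSerreRelations.exists_functional [Fintype I] (h : PreSerreRelations D q e f k k')
    (hq : IsGenericParam q) {lam : D.Weight} {v : V} (hv : v ∈ opWeightSpace D q k lam)
    (hv0 : v ≠ 0) (hspan : ⊤ ≤ Submodule.span ℂ (Set.range fun w => wordAct f w v)) :
    ∃ φ : V →ₗ[ℂ] ℂ, φ v ≠ 0 ∧ ∀ i x, φ (f i x) = 0 := by
  set S := Submodule.span ℂ (Set.range fun p : I × List I => wordAct f (p.1 :: p.2) v) with hS
  have hSle : S ≤ ⨆ γ ≠ lam, opWeightSpace D q k γ := by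
    rw [hS, Submodule.span_le]
    rintro _ ⟨⟨i, w⟩, rfl⟩
    have hne : wordWeight lam (i :: w) ≠ lam := fun h0 => by
      simpa using D.wordWeight_eq_self.1 h0
    exact Submodule.mem_iSup_of_mem _ (Submodule.mem_iSup_of_mem hne
      (h.wordAct_mem hq.1 hv (i :: w)))
  have hvS : v ∉ S := fun hmem => hv0 <| by
    have := (iSupIndep_opWeightSpace hq h.k_k lam).le_bot ⟨hv, hSle hmem⟩
    simpa using this
  obtain ⟨φ, hφv, hφS⟩ := Submodule.exists_le_ker_of_notMem hvS
  refine ⟨φ, hφv, fun i x => ?_⟩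
  have hx : x ∈ Submodule.span ℂ (Set.range fun w => wordAct f w v) := hspan trivial
  induction hx using Submodule.span_induction with
  | mem x hx =>
    obtain ⟨w, rfl⟩ := hx
    exact hφS (Submodule.subset_span ⟨(i, w), by simp⟩)
  | zero => simp
  | add x y _ _ hx hy => rw [map_add, map_add, hx, hy, add_zero]
  | smul c x _ hx => rw [map_smul, map_smul, hx, smul_zero]

end Cyclic

theorem exists_smul_eq {I : Type*} {D : CartanDatum I} {q : ℂ} {W : Type*} [AddCommGroup W]
    [Module (Uq D q) W] [IsSimpleModule (Uq D q) W] {v : W} (hv0 : v ≠ 0) (w : W) :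
    ∃ g : Uq D q, g • v = w :=
  IsSimpleModule.toSpanSingleton_surjective (Uq D q) hv0 w

section Sigma

variable {I : Type*} {D : CartanDatum I} {q : ℂ} {W : Type*} [AddCommGroup W]
  [Module ℂ W] [Module (Uq D q) W] [IsScalarTower ℂ (Uq D q) W]

/-- The action of `U_q(𝔤)` on the sum of a module and its twist by a diagram automorphism. -/
noncomputable def twistedSum (q : ℂ) (W : Type*) [AddCommGroup W] [Module ℂ W]
    [Module (Uq D q) W] [IsScalarTower ℂ (Uq D q) W] {σ : Equiv.Perm I}
    (hσ : D.IsDiagramAut σ) : Uq D q →ₐ[ℂ] Module.End ℂ (W × W) :=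
  (LinearMap.prodMapAlgHom ℂ W W).comp
    ((Algebra.lsmul ℂ ℂ W).prod ((Algebra.lsmul ℂ ℂ W).comp (Uq.diagramAut q hσ).toAlgHom))

theorem twistedSum_apply {σ : Equiv.Perm I} (hσ : D.IsDiagramAut σ) (g : Uq D q) (x : W × W) :
    twistedSum q W hσ g x = (g • x.1, Uq.diagramAut q hσ g • x.2) := rfl

variable [IsSimpleModule (Uq D q) W] {lam : D.Weight} {v : W}

theorem span_wordAct_eq_top (hq : q ≠ 0) (hv : v ∈ weightSpace D q W lam) (hv0 : v ≠ 0)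
    (hev : ∀ i, Uq.e D q i • v = 0) :
    ⊤ ≤ Submodule.span ℂ
      (Set.range fun w => wordAct (fun i => Uq.op D q W (Uq.gen D q (.f i))) w v) := by
  intro x _
  obtain ⟨g, rfl⟩ := exists_smul_eq (D := D) (q := q) hv0 x
  rw [weightSpace_eq_opWeightSpace] at hv
  exact Uq.apply_mem_span_wordAct (Algebra.lsmul ℂ ℂ W) hq hv hev g

theorem weightSpace_highest_eq_span [Fintype I] (hq : IsGenericParam q) (hv : v ∈ weightSpace D q W lam)
    (hv0 : v ≠ 0) (hev : ∀ i, Uq.e D q i • v = 0) :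
    weightSpace D q W lam = Submodule.span ℂ {v} := by
  have hspan := span_wordAct_eq_top hq.1 hv hv0 hev
  rw [weightSpace_eq_opWeightSpace] at hv ⊢
  rw [(Uq.op_preSerreRelations D q W).opWeightSpace_eq_span hq hv hspan]
  have : {w : List I | wordWeight lam w = lam} = {[]} := by
    ext w; exact D.wordWeight_eq_self
  rw [this, Set.image_singleton, wordAct_nil]

/-- The annihilator of the highest weight vector is stable under the diagram automorphism. Otherwise
the submodule of the sum of `W` and its twist generated by `(v, v)` would contain `(0, v)`, but it
is killed by the functional that compares the coefficients of `v` in both components. -/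
theorem diagramAut_smul_eq_zero [Fintype I] (hq : IsGenericParam q) {σ : Equiv.Perm I}
    (hσ : D.IsDiagramAut σ) (hlam : ∀ i, lam (σ i) = lam i) (hv : v ∈ weightSpace D q W lam)
    (hv0 : v ≠ 0) (hev : ∀ i, Uq.e D q i • v = 0) {g : Uq D q} (hg : g • v = 0) :
    Uq.diagramAut q hσ g • v = 0 := by
  by_contra hne
  obtain ⟨a, ha⟩ := exists_smul_eq (D := D) (q := q) hne v
  set b := (Uq.diagramAut q hσ).symm a with hb
  have hab : twistedSum q W hσ (b * g) (v, v) = (0, v) := by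
    rw [twistedSum_apply]
    simp only [map_mul, mul_smul, hg, smul_zero, hb, AlgEquiv.apply_symm_apply, ha]
  have hspan := span_wordAct_eq_top hq.1 hv hv0 hev
  have hv' := hv
  rw [weightSpace_eq_opWeightSpace] at hv'
  obtain ⟨φ, hφv, hφf⟩ :=
    (Uq.op_preSerreRelations D q W).exists_functional hq hv' hv0 hspan
  have hmem := Uq.apply_mem_span_wordAct (twistedSum q W hσ) hq.1 (lam := lam) (v := (v, v)) ?_ ?_
    (b * g)
  · set ψ : W × W →ₗ[ℂ] ℂ := φ.comp (LinearMap.fst ℂ W W) - φ.comp (LinearMap.snd ℂ W W) with hψ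
    have hle : Submodule.span ℂ (Set.range fun w =>
        wordAct (fun i => twistedSum q W hσ (Uq.gen D q (.f i))) w (v, v)) ≤ LinearMap.ker ψ := by
      rw [Submodule.span_le]
      rintro _ ⟨w, rfl⟩
      rcases w with _ | ⟨i, w⟩
      · simp [hψ]
      · have h1 := hφf i (wordAct (fun i => twistedSum q W hσ (Uq.gen D q (.f i))) w (v, v)).1
        have h2 := hφf (σ i)
          (wordAct (fun i => twistedSum q W hσ (Uq.gen D q (.f i))) w (v, v)).2
        dsimp only
        rw [SetLike.mem_coe, LinearMap.mem_ker, wordAct_cons, twistedSum_apply,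
          Uq.diagramAut_gen]
        rw [hψ, LinearMap.sub_apply]
        exact sub_eq_zero.2 (h1.trans h2.symm)
    have := hle hmem
    rw [hab, LinearMap.mem_ker] at this
    simp [hψ] at this
    exact hφv this
  · refine mem_opWeightSpace.2 fun i => ?_
    rw [twistedSum_apply, Uq.diagramAut_gen, Prod.smul_mk]
    refine Prod.ext (hv i) ?_
    have := hv (σ i)
    rwa [hσ.2, hlam] at this
  · intro i
    rw [twistedSum_apply, Uq.diagramAut_gen]
    exact Prod.ext (hev i) (hev (σ i))

theorem exists_twist_map [Fintype I] (hq : IsGenericParam q) {σ : Equiv.Perm I}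
    (hσ : D.IsDiagramAut σ) (hlam : ∀ i, lam (σ i) = lam i) (hv : v ∈ weightSpace D q W lam)
    (hv0 : v ≠ 0) (hev : ∀ i, Uq.e D q i • v = 0) :
    ∃ s : W →ₗ[ℂ] W, ∀ g : Uq D q, s (g • v) = Uq.diagramAut q hσ g • v := by
  -- `c w` is an element of the quantum group with `c w • v = w`.
  choose c hc using exists_smul_eq (D := D) (q := q) hv0
  have key : ∀ g g' : Uq D q, g • v = g' • v →
      Uq.diagramAut q hσ g • v = Uq.diagramAut q hσ g' • v := by
    intro g g' h
    rw [← sub_eq_zero, ← sub_smul, ← map_sub]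
    exact diagramAut_smul_eq_zero hq hσ hlam hv hv0 hev (by rw [sub_smul, h, sub_self])
  refine ⟨⟨⟨fun w => Uq.diagramAut q hσ (c w) • v, fun w w' => ?_⟩, fun a w => ?_⟩, fun g => ?_⟩
  · rw [← add_smul, ← map_add]
    exact key _ _ (by rw [hc, add_smul, hc, hc])
  · rw [RingHom.id_apply, ← smul_assoc, ← map_smul]
    exact key _ _ (by rw [hc, smul_assoc, hc])
  · exact key _ _ (hc _)

end Sigma

namespace FoldingDatum

variable {I' : Type*} (F : FoldingDatum I') {q : ℂ}
  {W : Type*} [AddCommGroup W] [Module ℂ W] [Module (Uq F.toCartanDatum q) W]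
  [IsScalarTower ℂ (Uq F.toCartanDatum q) W]

theorem commute_of_C_eq_zero {i j : I'} (hq : IsGenericParam q) (hij : F.C i j = 0) :
    Commute (Uq.gen F.toCartanDatum q (.e i)) (Uq.gen F.toCartanDatum q (.e j)) ∧
      Commute (Uq.gen F.toCartanDatum q (.f i)) (Uq.gen F.toCartanDatum q (.f j)) := by
  have hne : i ≠ j := by
    rintro rfl
    rw [F.C_diag] at hij
    exact absurd hij (by norm_num)
  have key : ∀ (Q : ℂ), IsGenericParam Q → ∀ x y : Uq F.toCartanDatum q,
      serreElement Q (1 - F.C i j).toNat x y = 0 → Commute x y := by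
    intro Q hQ x y h
    rw [hij] at h
    simp [serreElement, Finset.sum_range_succ, qBinom_zero_right hQ, qBinom_self hQ] at h
    rw [← sub_eq_add_neg, sub_eq_zero] at h
    exact h
  exact ⟨key _ (hq.pow (F.d_pos i)) _ _ (Uq.serre_e hne),
    key _ (hq.pow (F.d_pos i)) _ _ (Uq.serre_f hne)⟩

theorem IsSigmaHat.apply_smul {lam : F.Weight} {s : W ≃ₗ[ℂ] W} (hs : F.IsSigmaHat q lam s)
    (g : Uq F.toCartanDatum q) (w : W) : s (g • w) = Uq.diagramAut q F.isDiagramAut g • s w := by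
  rw [hs.1, LinearEquiv.symm_apply_apply]

variable [Fintype I']

theorem existsUnique_isSigmaHat [IsSimpleModule (Uq F.toCartanDatum q) W] (hq : IsGenericParam q)
    {lam : F.Weight} (hlam : lam ∈ F.invWeights)
    (hW : HasHighestWeight F.toCartanDatum q W lam) :
    ∃! s : W ≃ₗ[ℂ] W, F.IsSigmaHat q lam s := by
  obtain ⟨v, hv, hv0, hev⟩ := hW
  obtain ⟨s, hs⟩ := exists_twist_map hq F.isDiagramAut hlam hv hv0 hev
  obtain ⟨t, ht⟩ := exists_twist_map hq F.isDiagramAut.symm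
    (fun i => by simpa using (hlam (F.σ.symm i)).symm) hv hv0 hev
  have hst : ∀ w, s (t w) = w := fun w => by
    obtain ⟨g, rfl⟩ := exists_smul_eq (D := F.toCartanDatum) (q := q) hv0 w
    rw [ht, hs]
    exact congrArg (· • v) ((Uq.diagramAut q F.isDiagramAut).apply_symm_apply g)
  have hts : ∀ w, t (s w) = w := fun w => by
    obtain ⟨g, rfl⟩ := exists_smul_eq (D := F.toCartanDatum) (q := q) hv0 w
    rw [hs, ht]
    exact congrArg (· • v) ((Uq.diagramAut q F.isDiagramAut).symm_apply_apply g)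
  let S : W ≃ₗ[ℂ] W := LinearEquiv.ofLinearMap s t (LinearMap.ext hst) (LinearMap.ext hts)
  refine ⟨S, ⟨fun g w => ?_, fun w hw => ?_⟩, fun S' hS' => ?_⟩
  · obtain ⟨u, rfl⟩ := S.surjective w
    rw [LinearEquiv.symm_apply_apply]
    obtain ⟨g', rfl⟩ := exists_smul_eq (D := F.toCartanDatum) (q := q) hv0 u
    change _ • s (g' • v) = s (g • g' • v)
    rw [← mul_smul, hs, hs, map_mul, mul_smul]
  · rw [weightSpace_highest_eq_span hq hv hv0 hev, Submodule.mem_span_singleton] at hw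
    obtain ⟨c, rfl⟩ := hw
    have : s v = v := by simpa using hs 1
    rw [map_smul]
    exact congrArg (c • ·) this
  · refine LinearEquiv.ext fun w => ?_
    obtain ⟨g, rfl⟩ := exists_smul_eq (D := F.toCartanDatum) (q := q) hv0 w
    have h1 := hS'.1 g (S' v)
    rw [LinearEquiv.symm_apply_apply, hS'.2 v hv] at h1
    rw [← h1]
    exact (hs g).symm

/-! ### Weyl group invariance of the character of the fixed part -/

theorem pairwise_toList_fibre (J : F.Orbit) :
    (F.fibre J).toList.Pairwise fun i j => F.C i j = 0 := by
  refine (F.fibre J).nodup_toList.imp_of_mem ?_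
  intro i j hi hj hij
  rw [Finset.mem_toList, mem_fibre] at hi hj
  exact F.orbit_not_adj i j (F.orb_eq.1 (hi.trans hj.symm)) hij

/-- The simple reflection of the folded diagram attached to an orbit is the product of the
commuting reflections in the nodes of the orbit. -/
theorem weightEquiv_simpleReflection (J : F.Orbit) (γ : F.langlandsDual.Weight) :
    (F.weightEquiv (F.langlandsDual.simpleReflection J γ) : F.Weight) =
      (F.weightEquiv γ : F.Weight) -
        γ J • ((F.fibre J).toList.map F.toCartanDatum.simpleRoot).sum := by
  rw [CartanDatum.simpleReflection_apply, Finset.sum_map_toList]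
  funext j
  change γ (F.orb j) - γ J • F.foldedCartan J (F.orb j) = γ (F.orb j) - _
  rw [foldedCartan_orb, Pi.smul_apply, Finset.sum_apply]
  congr 2
  exact Finset.sum_congr rfl fun i _ => F.C_symm i j

/-- A product over an orbit of powers of commuting generators is fixed by the automorphism. -/
theorem prod_fibre_map_σ (J : F.Orbit) {A : Type*} [Monoid A] (x : I' → A)
    (hx : ∀ i j, F.C i j = 0 → Commute (x i) (x j)) :
    ((F.fibre J).toList.map fun i => x (F.σ i)).prod = ((F.fibre J).toList.map x).prod := by
  have hperm : ((F.fibre J).toList.map F.σ).Perm (F.fibre J).toList := by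
    rw [List.perm_ext_iff_of_nodup
      ((List.nodup_map_iff F.σ.injective).2 (F.fibre J).nodup_toList) (F.fibre J).nodup_toList]
    intro i
    simp only [List.mem_map, Finset.mem_toList, mem_fibre]
    constructor
    · rintro ⟨j, hj, rfl⟩
      rw [F.orb_σ, hj]
    · intro hi
      refine ⟨F.σ.symm i, ?_, by simp⟩
      rw [← hi, ← F.orb_σ, Equiv.apply_symm_apply]
  have h1 : ((F.fibre J).toList.map fun i => x (F.σ i)) = ((F.fibre J).toList.map F.σ).map x := by
    rw [List.map_map]; rfl
  rw [h1]
  refine List.Perm.prod_eq' (hperm.map x) ?_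
  rw [List.pairwise_map, List.pairwise_map]
  refine (F.pairwise_toList_fibre J).imp fun {i j} hij => hx _ _ ?_
  rw [F.isDiagramAut.1, hij]

theorem IsSigmaHat.apply_reflectionOp {lam : F.Weight} {s : W ≃ₗ[ℂ] W}
    (hs : F.IsSigmaHat q lam s) (hq : IsGenericParam q) (m : ℤ) (J : F.Orbit) (w : W) :
    s (reflectionOp (fun i => Uq.op F.toCartanDatum q W (Uq.gen F.toCartanDatum q (.e i)))
        (fun i => Uq.op F.toCartanDatum q W (Uq.gen F.toCartanDatum q (.f i))) m
        (F.fibre J).toList w) =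
      reflectionOp (fun i => Uq.op F.toCartanDatum q W (Uq.gen F.toCartanDatum q (.e i)))
        (fun i => Uq.op F.toCartanDatum q W (Uq.gen F.toCartanDatum q (.f i))) m
        (F.fibre J).toList (s w) := by
  have key : ∀ (x : I' → Gen I') (n : ℕ), (∀ i, (x i).map F.σ = x (F.σ i)) →
      (∀ i j, F.C i j = 0 →
        Commute (Uq.gen F.toCartanDatum q (x i)) (Uq.gen F.toCartanDatum q (x j))) →
      ∀ w, s (((F.fibre J).toList.map fun i =>
          Uq.op F.toCartanDatum q W (Uq.gen F.toCartanDatum q (x i)) ^ n).prod w) =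
        ((F.fibre J).toList.map fun i =>
          Uq.op F.toCartanDatum q W (Uq.gen F.toCartanDatum q (x i)) ^ n).prod (s w) := by
    intro x n hx hcomm w
    set g := ((F.fibre J).toList.map fun i => Uq.gen F.toCartanDatum q (x i) ^ n).prod with hg
    have hop : ((F.fibre J).toList.map fun i =>
        Uq.op F.toCartanDatum q W (Uq.gen F.toCartanDatum q (x i)) ^ n).prod =
        Uq.op F.toCartanDatum q W g := by
      rw [hg, Uq.op, map_list_prod, List.map_map]
      congr 2
      funext i
      simp [map_pow]
    have hσ : Uq.diagramAut q F.isDiagramAut g = g := by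
      rw [hg, map_list_prod, List.map_map, ← F.prod_fibre_map_σ J
        (fun i => Uq.gen F.toCartanDatum q (x i) ^ n) fun i j hij => (hcomm i j hij).pow_pow n n]
      congr 2
      funext i
      simp [map_pow, Uq.diagramAut_gen, hx]
    rw [hop]
    change s (g • w) = g • s w
    rw [hs.apply_smul, hσ]
  rw [reflectionOp]
  split_ifs with hm
  · exact key Gen.e _ (fun _ => rfl) (fun i j hij => (F.commute_of_C_eq_zero hq hij).1) w
  · exact key Gen.f _ (fun _ => rfl) (fun i j hij => (F.commute_of_C_eq_zero hq hij).2) w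

theorem finrank_fixedWeightSpace_le [FiniteDimensional ℂ W] {lam : F.Weight} {s : W ≃ₗ[ℂ] W}
    (hs : F.IsSigmaHat q lam s) (hq : IsGenericParam q) (J : F.Orbit)
    (γ : F.langlandsDual.Weight) :
    Module.finrank ℂ (F.fixedWeightSpace q s γ) ≤
      Module.finrank ℂ (F.fixedWeightSpace q s (F.langlandsDual.simpleReflection J γ)) := by
  set T := reflectionOp (fun i => Uq.op F.toCartanDatum q W (Uq.gen F.toCartanDatum q (.e i)))
    (fun i => Uq.op F.toCartanDatum q W (Uq.gen F.toCartanDatum q (.f i))) (γ J)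
    (F.fibre J).toList with hT
  have key : ∀ x ∈ F.fixedWeightSpace q s γ,
      T x ∈ F.fixedWeightSpace q s (F.langlandsDual.simpleReflection J γ) ∧ (T x = 0 → x = 0) := by
    intro x hx
    rw [mem_fixedWeightSpace] at hx ⊢
    obtain ⟨hx1, hx2⟩ := hx
    rw [weightSpace_eq_opWeightSpace] at hx2 ⊢
    have := (Uq.op_preSerreRelations F.toCartanDatum q W).reflectionOp_mem hq (m := γ J)
      (F.pairwise_toList_fibre J) (fun i hi => ?_) hx2
    · rw [F.weightEquiv_simpleReflection J γ]
      refine ⟨⟨?_, this.1⟩, this.2⟩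
      rw [hT, hs.apply_reflectionOp F hq, hx1]
    · rw [Finset.mem_toList, mem_fibre] at hi
      rw [← hi]
      rfl
  refine LinearMap.finrank_le_finrank_of_injective
    (f := T.restrict fun x hx => (key x hx).1) ?_
  rw [← LinearMap.ker_eq_bot, LinearMap.ker_eq_bot']
  intro x hx
  exact Subtype.ext ((key x x.2).2 (congrArg Subtype.val hx))

theorem coeff_fixedCharacter_simpleReflection [FiniteDimensional ℂ W] {lam : F.Weight}
    {s : W ≃ₗ[ℂ] W} (hs : F.IsSigmaHat q lam s) (hq : IsGenericParam q) (J : F.Orbit)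
    (γ : F.langlandsDual.Weight) :
    (F.fixedCharacter hq s).coeff (F.langlandsDual.simpleReflection J γ) =
      (F.fixedCharacter hq s).coeff γ := by
  change ((Module.finrank ℂ _ : ℕ) : ℤ) = (Module.finrank ℂ _ : ℕ)
  rw [Nat.cast_inj]
  refine le_antisymm ?_ (F.finrank_fixedWeightSpace_le hs hq J γ)
  have := F.finrank_fixedWeightSpace_le hs hq J (F.langlandsDual.simpleReflection J γ)
  rwa [CartanDatum.simpleReflection_simpleReflection] at this

end FoldingDatum

theorem CartanDatum.mapDomain_eq_of_invariant {I : Type*} {D : CartanDatum I}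
    {χ : AddMonoidAlgebra ℤ D.Weight}
    (hχ : ∀ i γ, χ.coeff (D.simpleReflection i γ) = χ.coeff γ) {w : D.Weight ≃ₗ[ℤ] D.Weight}
    (hw : w ∈ D.weylGroup) : AddMonoidAlgebra.mapDomain w χ = χ := by
  have key : ∀ γ, χ.coeff (w γ) = χ.coeff γ := by
    induction hw using Subgroup.closure_induction with
    | mem w hw => obtain ⟨i, rfl⟩ := hw; exact hχ i
    | one => intro γ; rfl
    | mul w w' _ _ h h' => intro γ; exact (h (w' γ)).trans (h' γ)
    | inv w _ h =>
      intro γ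
      rw [← h (w⁻¹ γ)]
      exact congrArg χ.coeff (w.apply_symm_apply γ)
  ext γ
  obtain ⟨γ, rfl⟩ := w.surjective γ
  rw [key]
  exact Finsupp.mapDomain_apply w.injective _ _

end FoldedQG

open FoldedQG in
theorem mainTheorem10 {I' : Type*} [Fintype I'] (F : FoldingDatum I')
    (q : ℂ) (hq : IsGenericParam q)
    (W : Type*) [AddCommGroup W] [Module ℂ W] [Module (Uq F.toCartanDatum q) W]
    [IsScalarTower ℂ (Uq F.toCartanDatum q) W] [FiniteDimensional ℂ W]
    [IsSimpleModule (Uq F.toCartanDatum q) W]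
    (lam : F.Weight) (hlam : lam ∈ F.invWeights)
    (hW : HasHighestWeight F.toCartanDatum q W lam) :
    (∃! s : W ≃ₗ[ℂ] W, F.IsSigmaHat q lam s) ∧
    ∀ s : W ≃ₗ[ℂ] W, F.IsSigmaHat q lam s →
      (∀ w ∈ F.langlandsDual.weylGroup,
        AddMonoidAlgebra.mapDomain w (F.fixedCharacter hq s) = F.fixedCharacter hq s) ∧
      ∃ M N : FDRep F.langlandsDual q,
        F.fixedCharacter hq s =
          character F.langlandsDual M.carrier hq - character F.langlandsDual N.carrier hq := by
  refine ⟨F.existsUnique_isSigmaHat hq hlam hW, fun s hs => ?_⟩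
  have hinv := F.coeff_fixedCharacter_simpleReflection hs hq
  refine ⟨fun w hw => CartanDatum.mapDomain_eq_of_invariant hinv hw, ?_⟩
  have : Fintype F.Orbit := Fintype.ofFinite _
  exact mem_virtualCharacters_of_invariant hq hinv
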